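/- **Splines.** For $r,k\in\mathbb N$ let $\mathcal U^r_k$ be the space of $C^r$ functions on $[0,1]$ that are polynomials of degree $\le k$ on $[0,\frac12]$ and on $[\frac12,1]$, and let $\mathcal R^r_k=\mathcal U^r_k\otimes\mathcal U^r_k$, a space of functions on $[0,1]^2$. **Mesh.** Let $\mathcal M$ be a finite quad mesh: finitely many copies $\sigma$ of $[0,1]^2$ (the faces), some of whose sides are identified in pairs by isometries, each side with at most one other side, which belongs to a different face. $\mathcal M_0,\mathcal M_1,\mathcal M_2$ are the resulting sets of vertices, edges and faces. An edge is shared if it comes from two identified sides, and a boundary edge otherwise; a vertex is interior if all edges at it are shared. $F(\gamma)$ is the number of (face, corner) pairs at the vertex $\gamma$. Edges at $\gamma$ are counted with multiplicity (an edge with both ends at $\gamma$ counts twice). **Gluing data.** Each shared edge $\tau$ with an end $\gamma$, and each choice $(\sigma_1,\sigma_0)$ of the order of its two faces, carries functions $\mathfrak a=a/c$, $\mathfrak b=b/c$ on $[0,1]$, where $a,b,c\in\mathcal U^s_l$ (for some $s,l$) and $b,c$ have no zero on $[0,1]$. Take coordinates with $\gamma=(0,0)$ in both faces, $\tau=\{v_1=0\}$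 in $\sigma_1$ and $\tau=\{u_0=0\}$ in $\sigma_0$. The transition map from $\sigma_1$ to $\sigma_0$ is, to first order along $\tau$, $(u_1,v_1)\mapsto(v_1\mathfrak b(u_1),\,u_1+v_1\mathfrak a(u_1))$. The data for the other order of the faces and for the other end of $\tau$ describe the inverse map and the same map in the other coordinates: exchanging the faces replaces $[a,b,c]$ by $[-a,c,b]$, and exchanging the ends replaces it by $[-a,b,c](1-u)$. The gluing conditions across $\tau$ are, for $u\in[0,1]$, $$f_1(u,0)=f_0(0,u),\qquad \frac{\partial f_1}{\partial v_1}(u,0)=\mathfrak b(u)\frac{\partial f_0}{\partial u_0}(0,u)+\mathfrak a(u)\frac{\partial f_0}{\partial v_0}(0,u)$$ (the second one for $u\ne\frac12$, which makes no difference if $r\ge1$). $\mathfrak c_\tau(\gamma)=1$ if $\tau$ is shared and $\mathfrak a(0)=0$ for the data at $\gamma$ ($\tau$ is a crossing edge at $\gamma$), and $\mathfrak c_\tau(\gamma)=0$ otherwise. $\mathfrak c_+(\gamma)=1$ if $\gamma$ is an interior vertex all of whose edges are crossing edges at $\gamma$ (a crossing vertex), and $\mathfrak c_+(\gamma)=0$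 otherwise. **Compatibility.** Suppose that the following holds at each interior vertex $\gamma$, for each cyclic numbering of its edges $\tau_1,\dots,\tau_F$, $F=F(\gamma)$, where $[\mathfrak a_i,\mathfrak b_i]$ are the data at $\gamma$ along $\tau_i$, with $\sigma_1$ the face between $\tau_{i-1}$ and $\tau_i$ and $\sigma_0$ the face between $\tau_i$ and $\tau_{i+1}$. 1. $\displaystyle\prod_{i=1}^{F}\begin{pmatrix}0&1\\ \mathfrak b_i(0)&\mathfrak a_i(0)\end{pmatrix}=\begin{pmatrix}1&0\\0&1\end{pmatrix}$, the factors being multiplied from left to right. 2. If $\gamma$ is a crossing vertex, then $F(\gamma)=4$ and $$\mathfrak a_1'(0)+\frac{\mathfrak b_4'(0)}{\mathfrak b_4(0)}=-\mathfrak b_1(0)\Bigl(\mathfrak a_3'(0)+\frac{\mathfrak b_2'(0)}{\mathfrak b_2(0)}\Bigr),\qquad \mathfrak a_2'(0)+\frac{\mathfrak b_1'(0)}{\mathfrak b_1(0)}=-\mathfrak b_2(0)\Bigl(\mathfrak a_4'(0)+\frac{\mathfrak b_3'(0)}{\mathfrak b_3(0)}\Bigr).$$ **Spline spaces and Taylor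 maps.** $\mathcal S^1_k(\mathcal M)$ is the space of families $(f_\sigma)_{\sigma\in\mathcal M_2}$, $f_\sigma\in\mathcal R^r_k$, that satisfy the gluing conditions across every shared edge. At a corner of a face, with coordinates in which the corner is $(0,0)$, the Taylor data of $f_\sigma$ are $[f_\sigma,\partial_uf_\sigma,\partial_vf_\sigma,\partial_u\partial_vf_\sigma](0,0)$. $T_\gamma$ collects the Taylor data at all the corners at $\gamma$, and $T=(T_\gamma)_{\gamma\in\mathcal M_0}$. The star $\mathcal M_\gamma$ consists of one face for each corner at $\gamma$, glued along the shared edges at $\gamma$. $\mathcal V_k(\gamma)$ is the space of families of functions in $\mathcal R^r_k$ on the faces of $\mathcal M_\gamma$ that satisfy the gluing conditions across the shared edges at $\gamma$ and vanish, together with their first order derivatives, along the edges of $\mathcal M_\gamma$ that do not contain $\gamma$. $\mathcal H(\gamma)$ is the space of Taylor data at the corners at $\gamma$ such that, for each shared edge $\tau$ at $\gamma$, the data $[p_1,q_1,\tilde q_1,s_1]$ on $\sigma_1$ and $[p_0,q_0,\tilde q_0,s_0]$ on $\sigma_0$ (in the coordinates above) satisfy, for some $\rho_\tau\in\mathbb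 R$, $$p_1=p_0,\quad q_1=\tilde q_0,\quad \tilde q_1=\mathfrak a(0)\tilde q_0+\mathfrak b(0)q_0,\quad s_1=2\mathfrak a(0)\rho_\tau+\mathfrak b(0)s_0+\mathfrak a'(0)\tilde q_0+\mathfrak b'(0)q_0 .$$ **Separability.** For a shared edge $\tau$ with ends $\gamma,\gamma'$, let $\mathcal M_\tau$ be its two faces glued along $\tau$ only, and let $\mathcal H_\tau(\gamma)$ be the space of pairs of Taylor data at $\gamma$ on these two faces that satisfy the four relations above. For a boundary edge, $\mathcal M_\tau$ is its face and $\mathcal H_\tau(\gamma)=\mathbb R^4$. The separability $\mathfrak s(\tau)$ is the least $k$ such that the image of $\mathcal S^{1}_k(\mathcal M_\tau)$ under $(T_\gamma,T_{\gamma'})$ is $\mathcal H_\tau(\gamma)\times\mathcal H_\tau(\gamma')$. **Statement.** (i) For each vertex $\gamma$ and each $k\ge\max\{\mathfrak s(\tau):\tau\ni\gamma\}$, $\;T_\gamma(\mathcal V_k(\gamma))=\mathcal H(\gamma)$. (ii) For each $k\ge\mathfrak s^*=\max\{\mathfrak s(\tau):\tau\in\mathcal M_1\}$, $\;T(\mathcal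 S^1_k(\mathcal M))=\prod_{\gamma\in\mathcal M_0}\mathcal H(\gamma)$ and $$\dim T(\mathcal S^1_k(\mathcal M))=\sum_{\gamma\in\mathcal M_0}(F(\gamma)+3)-\sum_{\gamma\in\mathcal M_0}\sum_{\tau\ni\gamma}\mathfrak c_\tau(\gamma)+\sum_{\gamma\in\mathcal M_0}\mathfrak c_+(\gamma).$$ -/

import Mathlib

open Polynomial Set

noncomputable section

namespace QuadSpline

/-! ## Spline functions -/

/-- Univariate splines of class `C^r` and degree at most `k` on the subdivision `0, 1/2, 1`.
Each of the two polynomial pieces is continued to its half line, so that a spline on `[0,1]` is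
represented by exactly one function on `ℝ`, and derivatives at `0` and `1` are ordinary ones. -/
def IsSpline (r k : ℕ) (f : ℝ → ℝ) : Prop :=
  ContDiff ℝ r f ∧ (∃ p : ℝ[X], p.natDegree ≤ k ∧ ∀ t ≤ 1 / 2, f t = p.eval t) ∧
    ∃ p : ℝ[X], p.natDegree ≤ k ∧ ∀ t, 1 / 2 ≤ t → f t = p.eval t

theorem IsSpline.differentiableAt {r k : ℕ} {f : ℝ → ℝ} (hf : IsSpline r k f) {t : ℝ}
    (ht : t ≠ 1 / 2) : DifferentiableAt ℝ f t := by
  obtain ⟨-, ⟨p, -, hp⟩, q, -, hq⟩ := hf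
  rcases lt_or_gt_of_ne ht with h | h
  · refine (p.differentiable.differentiableAt (x := t)).congr_of_eventuallyEq ?_
    filter_upwards [Iio_mem_nhds h] with s hs using hp s (le_of_lt hs)
  · refine (q.differentiable.differentiableAt (x := t)).congr_of_eventuallyEq ?_
    filter_upwards [Ioi_mem_nhds h] with s hs using hq s (le_of_lt hs)

/-- The reflection `t ↦ 1 - t`, applied or not. -/
def refl (b : Bool) (t : ℝ) : ℝ := if b then 1 - t else t

theorem IsSpline.reflect {r k : ℕ} {f : ℝ → ℝ} (hf : IsSpline r k f) (b : Bool) :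
    IsSpline r k (fun t => f (refl b t)) := by
  cases b
  · simpa [refl] using hf
  · obtain ⟨h, ⟨p, hpd, hp⟩, q, hqd, hq⟩ := hf
    have hd : (1 - X : ℝ[X]).natDegree ≤ 1 := by
      refine (natDegree_sub_le _ _).trans ?_
      simp
    have key : ∀ s : ℝ[X], s.natDegree ≤ k → (s.comp (1 - X)).natDegree ≤ k := by
      intro s hs
      refine natDegree_comp_le.trans ?_
      calc s.natDegree * (1 - X : ℝ[X]).natDegree ≤ k * 1 := Nat.mul_le_mul hs hd
        _ = k := mul_one k
    have hr : ContDiff ℝ r (refl true) := by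
      have : refl true = fun t => 1 - t := by
        funext t
        simp [refl]
      rw [this]
      fun_prop
    refine ⟨h.comp hr, ⟨q.comp (1 - X), key q hqd, fun t ht => ?_⟩,
      p.comp (1 - X), key p hpd, fun t ht => ?_⟩
    · simp only [refl, if_true, eval_comp, eval_sub, eval_one, eval_X]
      exact hq _ (by linarith)
    · simp only [refl, if_true, eval_comp, eval_sub, eval_one, eval_X]
      exact hp _ (by linarith)

/-- Splines of class `C^r` and bi-degree at most `(k,k)` on the 4-split of the unit square: the
tensor product of the space of univariate splines with itself. -/
def patch (r k : ℕ) : Submodule ℝ (ℝ → ℝ → ℝ) :=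
  Submodule.span ℝ {F | ∃ g h : ℝ → ℝ, IsSpline r k g ∧ IsSpline r k h ∧ F = fun u v => g u * h v}

/-- The regularity of a spline patch that makes its partial derivatives additive. -/
theorem patch_regular {r k : ℕ} {F : ℝ → ℝ → ℝ} (hF : F ∈ patch r k) :
    (∀ u v, v ≠ 1 / 2 → DifferentiableAt ℝ (F u) v) ∧
    (∀ u v, u ≠ 1 / 2 → DifferentiableAt ℝ (fun t => F t v) u) ∧
    (∀ u v, u ≠ 1 / 2 → v ≠ 1 / 2 → DifferentiableAt ℝ (fun t => deriv (F t) v) u) := by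
  induction hF using Submodule.span_induction with
  | mem F hF =>
    obtain ⟨g, h, hg, hh, rfl⟩ := hF
    refine ⟨fun u v hv => (hh.differentiableAt hv).const_mul _,
      fun u v hu => (hg.differentiableAt hu).mul_const _, fun u v hu hv => ?_⟩
    have : (fun t => deriv (fun v => g t * h v) v) = fun t => g t * deriv h v := by
      funext t
      exact deriv_const_mul _ (hh.differentiableAt hv)
    rw [this]
    exact (hg.differentiableAt hu).mul_const _
  | zero =>
    refine ⟨fun u v _ => ?_, fun u v _ => ?_, fun u v _ _ => ?_⟩
    · exact differentiableAt_const (0 : ℝ)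
    · exact differentiableAt_const (0 : ℝ)
    · have : (fun t : ℝ => deriv ((0 : ℝ → ℝ → ℝ) t) v) = fun _ => 0 := by
        funext t
        exact deriv_const v (0 : ℝ)
      rw [this]
      exact differentiableAt_const (0 : ℝ)
  | add F G _ _ hF hG =>
    refine ⟨fun u v hv => (hF.1 u v hv).add (hG.1 u v hv),
      fun u v hu => (hF.2.1 u v hu).add (hG.2.1 u v hu), fun u v hu hv => ?_⟩
    have : (fun t => deriv ((F + G) t) v) = fun t => deriv (F t) v + deriv (G t) v := by
      funext t
      exact deriv_add (hF.1 t v hv) (hG.1 t v hv)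
    rw [this]
    exact (hF.2.2 u v hu hv).add (hG.2.2 u v hu hv)
  | smul c F _ hF =>
    refine ⟨fun u v hv => (hF.1 u v hv).const_mul c,
      fun u v hu => (hF.2.1 u v hu).const_mul c, fun u v hu hv => ?_⟩
    have : (fun t => deriv ((c • F) t) v) = fun t => c * deriv (F t) v := by
      funext t
      exact deriv_const_mul c (hF.1 t v hv)
    rw [this]
    exact (hF.2.2 u v hu hv).const_mul c

/-- The Taylor data `[f, ∂ᵤ f, ∂ᵥ f, ∂ᵤ∂ᵥ f]` at the origin. -/
def taylor (F : ℝ → ℝ → ℝ) : Fin 4 → ℝ :=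
  ![F 0 0, deriv (fun u => F u 0) 0, deriv (F 0) 0, deriv (fun u => deriv (F u) 0) 0]

theorem taylor_add {r k : ℕ} {F G : ℝ → ℝ → ℝ} (hF : F ∈ patch r k) (hG : G ∈ patch r k) :
    taylor (F + G) = taylor F + taylor G := by
  have h0 : (0 : ℝ) ≠ 1 / 2 := by norm_num
  obtain ⟨a1, a2, a3⟩ := patch_regular hF
  obtain ⟨b1, b2, b3⟩ := patch_regular hG
  have e : (fun u => deriv ((F + G) u) 0) = fun u => deriv (F u) 0 + deriv (G u) 0 := by
    funext t
    exact deriv_add (a1 t 0 h0) (b1 t 0 h0)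
  have e1 : deriv (fun u => (F + G) u 0) 0 = deriv (fun u => F u 0) 0 + deriv (fun u => G u 0) 0 :=
    deriv_add (a2 0 0 h0) (b2 0 0 h0)
  have e2 : deriv ((F + G) 0) 0 = deriv (F 0) 0 + deriv (G 0) 0 := deriv_add (a1 0 0 h0) (b1 0 0 h0)
  have e3 : deriv (fun u => deriv ((F + G) u) 0) 0 =
      deriv (fun u => deriv (F u) 0) 0 + deriv (fun u => deriv (G u) 0) 0 := by
    rw [e]
    exact deriv_add (a3 0 0 h0 h0) (b3 0 0 h0 h0)
  funext i
  fin_cases i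
  · rfl
  · exact e1
  · exact e2
  · exact e3

theorem taylor_smul {r k : ℕ} (c : ℝ) {F : ℝ → ℝ → ℝ} (hF : F ∈ patch r k) :
    taylor (c • F) = c • taylor F := by
  have h0 : (0 : ℝ) ≠ 1 / 2 := by norm_num
  obtain ⟨a1, a2, a3⟩ := patch_regular hF
  have e : (fun u => deriv ((c • F) u) 0) = fun u => c * deriv (F u) 0 := by
    funext t
    exact deriv_const_mul c (a1 t 0 h0)
  have e1 : deriv (fun u => (c • F) u 0) 0 = c * deriv (fun u => F u 0) 0 :=
    deriv_const_mul c (a2 0 0 h0)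
  have e2 : deriv ((c • F) 0) 0 = c * deriv (F 0) 0 := deriv_const_mul c (a1 0 0 h0)
  have e3 : deriv (fun u => deriv ((c • F) u) 0) 0 = c * deriv (fun u => deriv (F u) 0) 0 := by
    rw [e]
    exact deriv_const_mul c (a3 0 0 h0 h0)
  funext i
  fin_cases i
  · rfl
  · exact e1
  · exact e2
  · exact e3

/-! ## Quad meshes -/

/-- A corner of a face: the face is a copy of the unit square, and the corner is the point with
coordinates `0` (`false`) or `1` (`true`). -/
abbrev Corner (Φ : Type*) := Φ × Bool × Bool

/-- A corner of a face together with one of the two sides of the face at that corner (`false` for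
the side along the first coordinate, `true` for the side along the second). A flag is the same
thing as a coordinate system `(u,v)` of the face with the corner at `(0,0)`, the chosen side on
the axis `v = 0`, and the other side at the corner on the axis `u = 0`. -/
abbrev FaceFlag (Φ : Type*) := Corner Φ × Bool

/-- Same corner, other side: `(u,v)` becomes `(v,u)`. -/
def FaceFlag.swap {Φ : Type*} (x : FaceFlag Φ) : FaceFlag Φ := (x.1, !x.2)

/-- Same side, other end point: `(u,v)` becomes `(1-u,v)`. -/
def FaceFlag.flip {Φ : Type*} (x : FaceFlag Φ) : FaceFlag Φ :=
  if x.2 then ((x.1.1, x.1.2.1, !x.1.2.2), x.2) else ((x.1.1, !x.1.2.1, x.1.2.2), x.2)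

/-- A topological surface made of quadrangular faces: some sides are glued in pairs, each with at
most one side, which belongs to a different face. `glue x = some y` says that the side of `x` is
glued to the side of `y`, the corner of `x` being identified with the corner of `y` (so points
with the same coordinate `u` are identified); `glue x = none` says that the side is on the
boundary. -/
structure QuadMesh (Φ : Type*) where
  glue : FaceFlag Φ → Option (FaceFlag Φ)
  glue_symm : ∀ x y, glue x = some y → glue y = some x
  glue_ne : ∀ x y, glue x = some y → x.1.1 ≠ y.1.1
  glue_flip : ∀ x, glue x.flip = (glue x).map FaceFlag.flip

variable {Φ : Type*}

namespace QuadMesh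

/-- The vertices of the surface: corners up to the identifications made by the gluing. -/
def Vertex (M : QuadMesh Φ) : Type _ :=
  Quot (fun κ l : Corner Φ => ∃ i j, M.glue (κ, i) = some (l, j))

/-- The vertex of the surface at a corner of a face. -/
def vertex (M : QuadMesh Φ) (κ : Corner Φ) : M.Vertex := Quot.mk _ κ

/-- The corners of faces at the vertex `γ`; they index the faces of the star of `γ`. -/
def CornersAt (M : QuadMesh Φ) (γ : M.Vertex) : Type _ := {κ : Corner Φ // M.vertex κ = γ}

/-- The number `F(γ)` of faces around the vertex `γ`. -/
def valence (M : QuadMesh Φ) (γ : M.Vertex) : ℕ := Nat.card (M.CornersAt γ)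

/-- The pairs (edge of the surface, one of its two ends). -/
def EdgeEnd (M : QuadMesh Φ) : Type _ := Quot (fun x y : FaceFlag Φ => M.glue x = some y)

/-- The end point of an edge, given by an edge end. -/
def EdgeEnd.point {M : QuadMesh Φ} (e : M.EdgeEnd) : M.Vertex :=
  Quot.lift (fun x : FaceFlag Φ => M.vertex x.1)
    (fun x y h => Quot.sound ⟨x.2, y.2, h⟩) e

/-- The edges at the vertex `γ`. -/
def EdgesAt (M : QuadMesh Φ) (γ : M.Vertex) : Type _ := {e : M.EdgeEnd // e.point = γ}

instance [Finite Φ] (M : QuadMesh Φ) : Fintype M.Vertex :=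
  haveI : Finite M.Vertex := inferInstanceAs (Finite (Quot _))
  Fintype.ofFinite _

instance [Finite Φ] (M : QuadMesh Φ) (γ : M.Vertex) : Fintype (M.EdgesAt γ) :=
  haveI : Finite M.EdgeEnd := inferInstanceAs (Finite (Quot _))
  haveI : Finite (M.EdgesAt γ) := inferInstanceAs (Finite {e : M.EdgeEnd // e.point = γ})
  Fintype.ofFinite _

end QuadMesh

/-! ## Gluing data -/

/-- Gluing data on a quad mesh, given by splines `a, b, c` of class `C^s` and degree at most `l`
on each shared edge. If `glue x = some y`, the transition map from the face of `x` to the face of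
`y` is, to first order along the edge and in the coordinates of `x` and of `y.swap`,
`(u,v) ↦ (v b(u)/c(u), u + v a(u)/c(u))`. The last fields say that the transition map in the
opposite direction is its inverse, and that it is the same transition map which is expressed in
coordinates at the other end of the edge. -/
structure GluingData (M : QuadMesh Φ) (s l : ℕ) where
  a : FaceFlag Φ → ℝ → ℝ
  b : FaceFlag Φ → ℝ → ℝ
  c : FaceFlag Φ → ℝ → ℝ
  spline : ∀ x y, M.glue x = some y →
    IsSpline s l (a x) ∧ IsSpline s l (b x) ∧ IsSpline s l (c x)
  b_ne : ∀ x y, M.glue x = some y → ∀ u ∈ Icc (0 : ℝ) 1, b x u ≠ 0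
  c_ne : ∀ x y, M.glue x = some y → ∀ u ∈ Icc (0 : ℝ) 1, c x u ≠ 0
  inverse : ∀ x y, M.glue x = some y → a y = -a x ∧ b y = c x ∧ c y = b x
  reverse : ∀ x y, M.glue x = some y → ∀ u,
    a x.flip u = -a x (1 - u) ∧ b x.flip u = b x (1 - u) ∧ c x.flip u = c x (1 - u)

namespace GluingData

variable {M : QuadMesh Φ} {s l : ℕ} (D : GluingData M s l)

/-- The function `𝔞 = a / c` at the corner of `x` along the side of `x`. -/
def fa (x : FaceFlag Φ) (u : ℝ) : ℝ := D.a x u / D.c x u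

/-- The function `𝔟 = b / c` at the corner of `x` along the side of `x`. -/
def fb (x : FaceFlag Φ) (u : ℝ) : ℝ := D.b x u / D.c x u

/-- The side of `x` is a shared edge which is a crossing edge at the corner of `x`. -/
def IsCrossing (x : FaceFlag Φ) : Prop := (M.glue x).isSome ∧ D.fa x 0 = 0

/-- A crossing vertex: an interior vertex at which all the edges are crossing edges. -/
def IsCrossingVertex (γ : M.Vertex) : Prop := ∀ x : FaceFlag Φ, M.vertex x.1 = γ → D.IsCrossing x

open Classical in
/-- `𝔠_τ(γ)`; it is zero for a boundary edge. -/
def crossEdge (e : M.EdgeEnd) : ℕ :=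
  if ∃ x : FaceFlag Φ, (Quot.mk _ x : M.EdgeEnd) = e ∧ D.IsCrossing x then 1 else 0

open Classical in
/-- `𝔠_+(γ)`. -/
def crossVertex (γ : M.Vertex) : ℕ := if D.IsCrossingVertex γ then 1 else 0

end GluingData

/-- The coordinate systems `z 0, z 1, z 2, …` run through the faces around the vertex `γ`, each
being adjacent to the next one along the axis `v = 0` of the former, which is the axis `u = 0` of
the latter. Such a sequence exists (and is periodic) exactly when `γ` is an interior vertex. -/
def QuadMesh.RunsAround (M : QuadMesh Φ) (γ : M.Vertex) (z : ℕ → FaceFlag Φ) : Prop :=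
  M.vertex (z 0).1 = γ ∧ ∀ i, M.glue (z i) = some (z (i + 1)).swap

namespace GluingData

variable {M : QuadMesh Φ} {s l : ℕ} (D : GluingData M s l)

/-- The first compatibility condition at a vertex: going once around an interior vertex, the
first order expansions of the transition maps compose to the identity. -/
def CompatibleAt (γ : M.Vertex) : Prop :=
  ∀ z : ℕ → FaceFlag Φ, M.RunsAround γ z →
    ((List.range (M.valence γ)).map
      (fun i => (!![0, 1; D.fb (z i) 0, D.fa (z i) 0] : Matrix (Fin 2) (Fin 2) ℝ))).prod = 1

/-- The second compatibility condition at a vertex: a crossing vertex has four edges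
`τ₁, …, τ₄`, and the derivatives of the gluing data satisfy two relations. -/
def CrossCompatibleAt (γ : M.Vertex) : Prop :=
  D.IsCrossingVertex γ → M.valence γ = 4 ∧ ∀ z : ℕ → FaceFlag Φ, M.RunsAround γ z →
    deriv (D.fa (z 1)) 0 + deriv (D.fb (z 4)) 0 / D.fb (z 4) 0 =
        -D.fb (z 1) 0 * (deriv (D.fa (z 3)) 0 + deriv (D.fb (z 2)) 0 / D.fb (z 2) 0) ∧
      deriv (D.fa (z 2)) 0 + deriv (D.fb (z 1)) 0 / D.fb (z 1) 0 =
        -D.fb (z 2) 0 * (deriv (D.fa (z 4)) 0 + deriv (D.fb (z 3)) 0 / D.fb (z 3) 0)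

/-! ## Splines along one edge and the separability of an edge -/

/-- The space `S_k^{1,r}(M_τ)` for the shared edge `τ` of `x`: pairs of patches, one on the face
of `x` and one on the face of `glue x`, both in coordinates `(u,v)` with `τ` on the axis `v = 0`
and the corner of `x` at the origin, that agree to first order along `τ` through the transition
map. The tangential derivative is evaluated away from the knot `1/2`, where it need not exist if
`r = 0`; if `r ≥ 1` the relation holds there by continuity. -/
def edgeSplines (r k : ℕ) (x : FaceFlag Φ) : Submodule ℝ ((ℝ → ℝ → ℝ) × (ℝ → ℝ → ℝ)) where
  carrier := {P | P.1 ∈ patch r k ∧ P.2 ∈ patch r k ∧ ∀ u ∈ Icc (0 : ℝ) 1,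
    P.1 u 0 = P.2 u 0 ∧
    (u ≠ 1 / 2 → deriv (fun v => P.1 u v) 0 =
      D.fb x u * deriv (fun v => P.2 u v) 0 + D.fa x u * deriv (fun t => P.2 t 0) u)}
  zero_mem' := by
    refine ⟨zero_mem _, zero_mem _, fun u _ => ⟨rfl, fun _ => ?_⟩⟩
    simp
  add_mem' := by
    rintro ⟨F, G⟩ ⟨F', G'⟩ ⟨hF, hG, h⟩ ⟨hF', hG', h'⟩
    have h0 : (0 : ℝ) ≠ 1 / 2 := by norm_num
    refine ⟨add_mem hF hF', add_mem hG hG', fun u hu => ⟨?_, fun hne => ?_⟩⟩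
    · exact congrArg₂ (· + ·) (h u hu).1 (h' u hu).1
    · have e1 : deriv (fun v => (F + F') u v) 0 = deriv (fun v => F u v) 0 + deriv (fun v => F' u v) 0 :=
        deriv_add ((patch_regular hF).1 u 0 h0) ((patch_regular hF').1 u 0 h0)
      have e2 : deriv (fun v => (G + G') u v) 0 = deriv (fun v => G u v) 0 + deriv (fun v => G' u v) 0 :=
        deriv_add ((patch_regular hG).1 u 0 h0) ((patch_regular hG').1 u 0 h0)
      have e3 : deriv (fun t => (G + G') t 0) u = deriv (fun t => G t 0) u + deriv (fun t => G' t 0) u :=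
        deriv_add ((patch_regular hG).2.1 u 0 hne) ((patch_regular hG').2.1 u 0 hne)
      have i1 := (h u hu).2 hne
      have i2 := (h' u hu).2 hne
      simp only [Prod.mk_add_mk] at i1 i2 ⊢
      rw [e1, e2, e3, i1, i2]
      ring
  smul_mem' := by
    rintro c ⟨F, G⟩ ⟨hF, hG, h⟩
    have h0 : (0 : ℝ) ≠ 1 / 2 := by norm_num
    refine ⟨Submodule.smul_mem _ c hF, Submodule.smul_mem _ c hG, fun u hu => ⟨?_, fun hne => ?_⟩⟩
    · exact congrArg (c * ·) (h u hu).1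
    · have e1 : deriv (fun v => (c • F) u v) 0 = c * deriv (fun v => F u v) 0 :=
        deriv_const_mul c ((patch_regular hF).1 u 0 h0)
      have e2 : deriv (fun v => (c • G) u v) 0 = c * deriv (fun v => G u v) 0 :=
        deriv_const_mul c ((patch_regular hG).1 u 0 h0)
      have e3 : deriv (fun t => (c • G) t 0) u = c * deriv (fun t => G t 0) u :=
        deriv_const_mul c ((patch_regular hG).2.1 u 0 hne)
      have i1 := (h u hu).2 hne
      simp only [Prod.smul_mk] at i1 ⊢
      rw [e1, e2, e3, i1]
      ring

/-- The space `H(γ)` for one shared edge: the Taylor data `[p, q, q', s]` on the face of `x` and on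
the face of `glue x` (`q` tangential, `q'` transversal to the edge) that solve, for some value `ρ`
of half the second tangential derivative, the relations implied by the gluing conditions. -/
def edgeTaylorSpace (x : FaceFlag Φ) : Submodule ℝ ((Fin 4 → ℝ) × (Fin 4 → ℝ)) where
  carrier := {P | P.1 0 = P.2 0 ∧ P.1 1 = P.2 1 ∧
    P.1 2 = D.fa x 0 * P.2 1 + D.fb x 0 * P.2 2 ∧
    ∃ ρ : ℝ, P.1 3 = 2 * D.fa x 0 * ρ + D.fb x 0 * P.2 3
      + deriv (D.fa x) 0 * P.2 1 + deriv (D.fb x) 0 * P.2 2}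
  zero_mem' := by
    refine ⟨rfl, rfl, ?_, 0, ?_⟩ <;> simp
  add_mem' := by
    rintro P Q ⟨h0, h1, h2, ρ, h3⟩ ⟨k0, k1, k2, σ, k3⟩
    refine ⟨?_, ?_, ?_, ρ + σ, ?_⟩ <;>
      simp only [Prod.fst_add, Prod.snd_add, Pi.add_apply]
    · rw [h0, k0]
    · rw [h1, k1]
    · rw [h2, k2]; ring
    · rw [h3, k3]; ring
  smul_mem' := by
    rintro c P ⟨h0, h1, h2, ρ, h3⟩
    refine ⟨?_, ?_, ?_, c * ρ, ?_⟩ <;>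
      simp only [Prod.smul_fst, Prod.smul_snd, Pi.smul_apply, smul_eq_mul]
    · rw [h0]
    · rw [h1]
    · rw [h2]; ring
    · rw [h3]; ring

/-- In degree `k` the Taylor maps at the two ends of the edge of `x` are onto and separated: for a
shared edge `τ` with ends `γ`, `γ'`, the image of `S_k^{1,r}(M_τ)` under `(T_γ, T_γ')` is
`H(γ) × H(γ')`; for a boundary edge there is one face, no gluing condition, and no relation
between Taylor data. -/
def IsSeparated (r k : ℕ) (x : FaceFlag Φ) : Prop :=
  ((M.glue x).isSome →
    (fun P : (ℝ → ℝ → ℝ) × (ℝ → ℝ → ℝ) =>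
      ((taylor P.1, taylor P.2),
        (taylor (fun u v => P.1 (1 - u) v), taylor (fun u v => P.2 (1 - u) v)))) ''
      (D.edgeSplines r k x : Set ((ℝ → ℝ → ℝ) × (ℝ → ℝ → ℝ))) =
    (D.edgeTaylorSpace x : Set ((Fin 4 → ℝ) × (Fin 4 → ℝ))) ×ˢ
      (D.edgeTaylorSpace x.flip : Set ((Fin 4 → ℝ) × (Fin 4 → ℝ)))) ∧
  (M.glue x = none →
    (fun F : ℝ → ℝ → ℝ => (taylor F, taylor (fun u v => F (1 - u) v))) ''
      (patch r k : Set (ℝ → ℝ → ℝ)) = univ)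

/-- The separability of the edge of `x`: the least degree in which the Taylor maps at its ends are
separated. -/
def separability (r : ℕ) (x : FaceFlag Φ) : ℕ∞ := ⨅ (k : ℕ) (_ : D.IsSeparated r k x), (k : ℕ∞)

end GluingData

/-! ## Splines on the mesh and on the star of a vertex -/

/-- A function on a square in coordinates `(u,v)`, or (`true`) in the coordinates `(v,u)`. -/
def orient (i : Bool) (F : ℝ → ℝ → ℝ) : ℝ → ℝ → ℝ := fun u v => if i then F v u else F u v

/-- Taylor data in coordinates `(u,v)`, or (`true`) in the coordinates `(v,u)`. -/
def orientTaylor (i : Bool) (h : Fin 4 → ℝ) : Fin 4 → ℝ :=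
  if i then ![h 0, h 2, h 1, h 3] else h

/-- The function `f` on the square with the corner `κ` moved to the origin. -/
def atCorner (κ : Corner Φ) (f : ℝ → ℝ → ℝ) : ℝ → ℝ → ℝ :=
  fun u v => f (refl κ.2.1 u) (refl κ.2.2 v)

theorem atCorner_mem {r k : ℕ} (κ : Corner Φ) {F : ℝ → ℝ → ℝ} (hF : F ∈ patch r k) :
    atCorner κ F ∈ patch r k := by
  induction hF using Submodule.span_induction with
  | mem F hF =>
    obtain ⟨g, h, hg, hh, rfl⟩ := hF
    exact Submodule.subset_span ⟨_, _, hg.reflect κ.2.1, hh.reflect κ.2.2, rfl⟩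
  | zero => exact zero_mem _
  | add F G _ _ hF hG => exact add_mem hF hG
  | smul c F _ hF => exact Submodule.smul_mem _ c hF

theorem orient_add (i : Bool) (F G : ℝ → ℝ → ℝ) : orient i (F + G) = orient i F + orient i G := by
  funext u v; cases i <;> rfl

theorem orient_smul (i : Bool) (c : ℝ) (F : ℝ → ℝ → ℝ) : orient i (c • F) = c • orient i F := by
  funext u v; cases i <;> rfl

theorem orient_zero (i : Bool) : orient i 0 = 0 := by
  funext u v; cases i <;> rfl

theorem orientTaylor_add (i : Bool) (h k : Fin 4 → ℝ) :
    orientTaylor i (h + k) = orientTaylor i h + orientTaylor i k := by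
  cases i
  · rfl
  · funext n; fin_cases n <;> rfl

theorem orientTaylor_smul (i : Bool) (c : ℝ) (h : Fin 4 → ℝ) :
    orientTaylor i (c • h) = c • orientTaylor i h := by
  cases i
  · rfl
  · funext n; fin_cases n <;> rfl

theorem orientTaylor_zero (i : Bool) : orientTaylor i 0 = 0 := by
  cases i
  · rfl
  · funext n; fin_cases n <;> rfl

namespace GluingData

variable {M : QuadMesh Φ} {s l : ℕ} (D : GluingData M s l)

/-- The space `S_k^{1,r}(M)`: a spline on every face, such that the gluing conditions hold along
every shared edge. -/
def splines (r k : ℕ) : Submodule ℝ (Φ → ℝ → ℝ → ℝ) where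
  carrier := {f | (∀ σ, f σ ∈ patch r k) ∧ ∀ (κ μ : Corner Φ) (i j : Bool),
    M.glue (κ, i) = some (μ, j) →
      (orient i (atCorner κ (f κ.1)), orient j (atCorner μ (f μ.1))) ∈ D.edgeSplines r k (κ, i)}
  zero_mem' := by
    refine ⟨fun σ => zero_mem _, fun κ μ i j _ => ?_⟩
    have : ∀ (ν : Corner Φ) (n : Bool), orient n (atCorner ν ((0 : Φ → ℝ → ℝ → ℝ) ν.1)) = 0 :=
      fun ν n => orient_zero n
    rw [this, this]
    exact zero_mem _
  add_mem' := by
    rintro f g ⟨hf, hf'⟩ ⟨hg, hg'⟩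
    refine ⟨fun σ => add_mem (hf σ) (hg σ), fun κ μ i j h => ?_⟩
    have : ∀ (ν : Corner Φ) (n : Bool), orient n (atCorner ν ((f + g) ν.1)) =
        orient n (atCorner ν (f ν.1)) + orient n (atCorner ν (g ν.1)) :=
      fun ν n => orient_add n _ _
    rw [this, this]
    exact add_mem (hf' κ μ i j h) (hg' κ μ i j h)
  smul_mem' := by
    rintro c f ⟨hf, hf'⟩
    refine ⟨fun σ => Submodule.smul_mem _ c (hf σ), fun κ μ i j h => ?_⟩
    have : ∀ (ν : Corner Φ) (n : Bool), orient n (atCorner ν ((c • f) ν.1)) =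
        c • orient n (atCorner ν (f ν.1)) := fun ν n => orient_smul n c _
    rw [this, this]
    exact Submodule.smul_mem _ c (hf' κ μ i j h)

/-- The Taylor map `T` at all the vertices on all the faces. -/
def taylorMap (r k : ℕ) :
    D.splines r k →ₗ[ℝ] ((γ : M.Vertex) → M.CornersAt γ → Fin 4 → ℝ) where
  toFun f := fun _ κ => taylor (atCorner κ.1 (f.1 κ.1.1))
  map_add' f g := by
    funext γ κ
    exact taylor_add (atCorner_mem κ.1 (f.2.1 _)) (atCorner_mem κ.1 (g.2.1 _))
  map_smul' c f := by
    funext γ κ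
    exact taylor_smul c (atCorner_mem κ.1 (f.2.1 _))

/-- The space `V_k(γ)`: splines on the star `M_γ` of `γ` (one face for each corner at `γ`, in
coordinates with `γ` at the origin, glued along the shared edges at `γ`) that vanish together
with their first order derivatives along the edges of the star that do not contain `γ`. -/
def vertexSplines (r k : ℕ) (γ : M.Vertex) : Submodule ℝ (M.CornersAt γ → ℝ → ℝ → ℝ) where
  carrier := {f | (∀ κ, f κ ∈ patch r k) ∧
    (∀ (κ μ : M.CornersAt γ) (i j : Bool), M.glue (κ.1, i) = some (μ.1, j) →
      (orient i (f κ), orient j (f μ)) ∈ D.edgeSplines r k (κ.1, i)) ∧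
    ∀ κ, ∀ t ∈ Icc (0 : ℝ) 1, f κ 1 t = 0 ∧ deriv (fun u => f κ u t) 1 = 0 ∧
      f κ t 1 = 0 ∧ deriv (fun v => f κ t v) 1 = 0}
  zero_mem' := by
    refine ⟨fun κ => zero_mem _, fun κ μ i j _ => ?_, fun κ t _ => ⟨rfl, ?_, rfl, ?_⟩⟩
    · simp only [Pi.zero_apply, orient_zero]
      exact zero_mem _
    · simp
    · simp
  add_mem' := by
    rintro f g ⟨hf, hf', hf''⟩ ⟨hg, hg', hg''⟩
    have h1 : (1 : ℝ) ≠ 1 / 2 := by norm_num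
    refine ⟨fun κ => add_mem (hf κ) (hg κ), fun κ μ i j h => ?_, fun κ t ht => ?_⟩
    · simp only [Pi.add_apply, orient_add]
      exact add_mem (hf' κ μ i j h) (hg' κ μ i j h)
    · obtain ⟨a1, a2, a3, a4⟩ := hf'' κ t ht
      obtain ⟨b1, b2, b3, b4⟩ := hg'' κ t ht
      have e2 : deriv (fun u => (f + g) κ u t) 1 =
          deriv (fun u => f κ u t) 1 + deriv (fun u => g κ u t) 1 :=
        deriv_add ((patch_regular (hf κ)).2.1 1 t h1) ((patch_regular (hg κ)).2.1 1 t h1)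
      have e4 : deriv (fun v => (f + g) κ t v) 1 =
          deriv (fun v => f κ t v) 1 + deriv (fun v => g κ t v) 1 :=
        deriv_add ((patch_regular (hf κ)).1 t 1 h1) ((patch_regular (hg κ)).1 t 1 h1)
      refine ⟨?_, by rw [e2, a2, b2, add_zero], ?_, by rw [e4, a4, b4, add_zero]⟩
      · simp only [Pi.add_apply, a1, b1, add_zero]
      · simp only [Pi.add_apply, a3, b3, add_zero]
  smul_mem' := by
    rintro c f ⟨hf, hf', hf''⟩
    have h1 : (1 : ℝ) ≠ 1 / 2 := by norm_num
    refine ⟨fun κ => Submodule.smul_mem _ c (hf κ), fun κ μ i j h => ?_, fun κ t ht => ?_⟩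
    · simp only [Pi.smul_apply, orient_smul]
      exact Submodule.smul_mem _ c (hf' κ μ i j h)
    · obtain ⟨a1, a2, a3, a4⟩ := hf'' κ t ht
      have e2 : deriv (fun u => (c • f) κ u t) 1 = c * deriv (fun u => f κ u t) 1 :=
        deriv_const_mul c ((patch_regular (hf κ)).2.1 1 t h1)
      have e4 : deriv (fun v => (c • f) κ t v) 1 = c * deriv (fun v => f κ t v) 1 :=
        deriv_const_mul c ((patch_regular (hf κ)).1 t 1 h1)
      refine ⟨?_, by rw [e2, a2, mul_zero], ?_, by rw [e4, a4, mul_zero]⟩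
      · simp only [Pi.smul_apply, a1, smul_zero]
      · simp only [Pi.smul_apply, a3, smul_zero]

/-- The Taylor map `T_γ` on `V_k(γ)`. -/
def vertexTaylorMap (r k : ℕ) (γ : M.Vertex) :
    D.vertexSplines r k γ →ₗ[ℝ] (M.CornersAt γ → Fin 4 → ℝ) where
  toFun f := fun κ => taylor (f.1 κ)
  map_add' f g := by
    funext κ
    exact taylor_add (f.2.1 κ) (g.2.1 κ)
  map_smul' c f := by
    funext κ
    exact taylor_smul c (f.2.1 κ)

/-- The space `H(γ)`: Taylor data `[p, q_i, q_{i+1}, s_i]` on the faces around `γ` that satisfy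
the relations implied by the gluing conditions across each shared edge at `γ`. -/
def taylorSpace (γ : M.Vertex) : Submodule ℝ (M.CornersAt γ → Fin 4 → ℝ) where
  carrier := {h | ∀ (κ μ : M.CornersAt γ) (i j : Bool), M.glue (κ.1, i) = some (μ.1, j) →
    (orientTaylor i (h κ), orientTaylor j (h μ)) ∈ D.edgeTaylorSpace (κ.1, i)}
  zero_mem' := by
    intro κ μ i j _
    simp only [Pi.zero_apply, orientTaylor_zero]
    exact zero_mem _
  add_mem' := by
    intro f g hf hg κ μ i j h
    simp only [Pi.add_apply, orientTaylor_add]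
    exact add_mem (hf κ μ i j h) (hg κ μ i j h)
  smul_mem' := by
    intro c f hf κ μ i j h
    simp only [Pi.smul_apply, orientTaylor_smul]
    exact Submodule.smul_mem _ c (hf κ μ i j h)

end GluingData

end QuadSpline

end

/-!
Everything is done one vertex and one edge at a time.

*Taylor maps.* That Taylor data of splines satisfy the relations that define `taylorSpace` is the
expansion at the corner of the gluing conditions (`taylor_mem_edgeTaylorSpace`). Conversely, let
Taylor data in `H(γ)` be given. By separability each edge at `γ` carries a spline with these data
at `γ` and zero data at the other end. A spline on the star needs to have, along each edge at `γ`,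
the same value and normal derivative as that edge spline. Since the two edge splines on a face have
the same Taylor data at their common corner, such a patch is the Boolean sum of their Hermite
extensions (`exists_patch_of_sides`), and it is flat along the far sides because the data at the
other ends vanish. The two univariate Hermite splines that this needs are themselves traces of edge
splines (`IsSeparated.exists_hermitePair`), so that no lower bound on the degree enters. This gives
`range_vertexTaylorMap`. Adding up such star splines over all the corners of all the faces gives
`range_taylorMap`: along a side of a face only the two functions attached to its ends matter, and
each satisfies the gluing conditions.

*Dimension.* The corners at a vertex form a fan `z 0, …, z n`, which ends at two boundary edges or
closes up (`exists_isFan_of_boundary`, `exists_isFan_of_interior`). Along an open fan the Taylor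
data on one face determine those on the next, except for the mixed derivative if the edge between
them is not a crossing edge, so that there are `4 + n - ∑ 𝔠` parameters (`finrank_chain`). The
relation that closes the fan around an interior vertex follows from the others: in first order by
the first compatibility condition, and for the mixed derivative because the fan can be cut at a
non-crossing edge if there is one, and by the second compatibility condition if there is none. In
the latter case the cut edge is not counted, which accounts for `𝔠₊` (`finrank_taylorSpace`).
-/

noncomputable section

namespace QuadSpline

variable {Φ : Type*}

/-! ### Univariate splines and the traces of a patch on the axes -/

/-- The linear space of univariate splines. -/
def splineSpace (r k : ℕ) : Submodule ℝ (ℝ → ℝ) where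
  carrier := {f | IsSpline r k f}
  zero_mem' := ⟨contDiff_const, ⟨0, by simp, fun t _ => by simp⟩, 0, by simp, fun t _ => by simp⟩
  add_mem' := by
    rintro f g ⟨hf, ⟨p, hp, hp'⟩, q, hq, hq'⟩ ⟨hg, ⟨p₁, hp₁, hp₁'⟩, q₁, hq₁, hq₁'⟩
    refine ⟨hf.add hg, ⟨p + p₁, natDegree_add_le_of_degree_le hp hp₁, fun t ht => ?_⟩,
      q + q₁, natDegree_add_le_of_degree_le hq hq₁, fun t ht => ?_⟩
    · simp [hp' t ht, hp₁' t ht]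
    · simp [hq' t ht, hq₁' t ht]
  smul_mem' := by
    rintro c f ⟨hf, ⟨p, hp, hp'⟩, q, hq, hq'⟩
    refine ⟨contDiff_const.smul hf, ⟨c • p, (natDegree_smul_le c p).trans hp, fun t ht => ?_⟩,
      c • q, (natDegree_smul_le c q).trans hq, fun t ht => ?_⟩
    · simp [hp' t ht]
    · simp [hq' t ht]

theorem IsSpline.mono {r k k' : ℕ} (h : k ≤ k') {f : ℝ → ℝ} (hf : IsSpline r k f) :
    IsSpline r k' f := by
  obtain ⟨h0, ⟨p, hp, hp'⟩, q, hq, hq'⟩ := hf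
  exact ⟨h0, ⟨p, hp.trans h, hp'⟩, q, hq.trans h, hq'⟩

theorem patch_mono {r k k' : ℕ} (h : k ≤ k') : patch r k ≤ patch r k' :=
  Submodule.span_mono fun _ ⟨g, h', hg, hh, e⟩ => ⟨g, h', hg.mono h, hh.mono h, e⟩

theorem patch_mul {r k : ℕ} {g h : ℝ → ℝ} (hg : IsSpline r k g) (hh : IsSpline r k h) :
    (fun u v => g u * h v) ∈ patch r k :=
  Submodule.subset_span ⟨g, h, hg, hh, rfl⟩

theorem orient_mem {r k : ℕ} (i : Bool) {F : ℝ → ℝ → ℝ} (hF : F ∈ patch r k) :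
    orient i F ∈ patch r k := by
  cases i
  · exact hF
  induction hF using Submodule.span_induction with
  | mem F hF =>
    obtain ⟨g, h, hg, hh, rfl⟩ := hF
    exact Submodule.subset_span ⟨h, g, hh, hg, by funext u v; simp [orient, mul_comm]⟩
  | zero => exact zero_mem _
  | add F G _ _ hF hG => exact add_mem hF hG
  | smul c F _ hF => exact Submodule.smul_mem _ c hF

theorem orientTaylor_orientTaylor (i : Bool) (h : Fin 4 → ℝ) :
    orientTaylor i (orientTaylor i h) = h := by
  cases i
  · rfl
  · funext n; fin_cases n <;> rfl

/-- The value and the normal derivative of a patch along a line `v = v₀` off the knot are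
splines. -/
theorem patch_traces {r k : ℕ} {F : ℝ → ℝ → ℝ} (hF : F ∈ patch r k) :
    (∀ v, IsSpline r k fun u => F u v) ∧
    ∀ v, v ≠ 1 / 2 → IsSpline r k fun u => deriv (F u) v := by
  induction hF using Submodule.span_induction with
  | mem F hF =>
    obtain ⟨g, h, hg, hh, rfl⟩ := hF
    refine ⟨fun v => ?_, fun v hv => ?_⟩
    · have e : (fun u => g u * h v) = h v • g := by
        funext u
        exact mul_comm _ _
      exact e ▸ (splineSpace r k).smul_mem (h v) hg
    · have e : (fun u => deriv (fun v => g u * h v) v) = deriv h v • g := by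
        funext u
        rw [deriv_const_mul _ (hh.differentiableAt hv)]
        exact mul_comm _ _
      exact e ▸ (splineSpace r k).smul_mem (deriv h v) hg
  | zero =>
    refine ⟨fun v => (splineSpace r k).zero_mem, fun v _ => ?_⟩
    have : (fun u : ℝ => deriv ((0 : ℝ → ℝ → ℝ) u) v) = 0 := by
      funext u
      exact deriv_const v (0 : ℝ)
    rw [this]
    exact (splineSpace r k).zero_mem
  | add F G hF' hG' hF hG =>
    refine ⟨fun v => (splineSpace r k).add_mem (hF.1 v) (hG.1 v), fun v hv => ?_⟩
    have : (fun u => deriv ((F + G) u) v) = (fun u => deriv (F u) v) + fun u => deriv (G u) v := by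
      funext u
      exact deriv_add ((patch_regular hF').1 u v hv) ((patch_regular hG').1 u v hv)
    rw [this]
    exact (splineSpace r k).add_mem (hF.2 v hv) (hG.2 v hv)
  | smul c F hF' hF =>
    refine ⟨fun v => (splineSpace r k).smul_mem c (hF.1 v), fun v hv => ?_⟩
    have : (fun u => deriv ((c • F) u) v) = c • fun u => deriv (F u) v := by
      funext u
      exact deriv_const_mul c ((patch_regular hF').1 u v hv)
    rw [this]
    exact (splineSpace r k).smul_mem c (hF.2 v hv)

/-- The mixed partial derivatives of a patch commute off the knots. -/
theorem patch_deriv_comm {r k : ℕ} {F : ℝ → ℝ → ℝ} (hF : F ∈ patch r k) {u v : ℝ}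
    (hu : u ≠ 1 / 2) (hv : v ≠ 1 / 2) :
    deriv (fun t => deriv (F t) v) u = deriv (fun t => deriv (fun w => F w t) u) v := by
  induction hF using Submodule.span_induction with
  | mem F hF =>
    obtain ⟨g, h, hg, hh, rfl⟩ := hF
    have e1 : (fun t => deriv (fun v => g t * h v) v) = fun t => g t * deriv h v := by
      funext t
      exact deriv_const_mul _ (hh.differentiableAt hv)
    have e2 : (fun t => deriv (fun w => g w * h t) u) = fun t => deriv g u * h t := by
      funext t
      exact deriv_mul_const (hg.differentiableAt hu) _
    rw [e1, e2, deriv_const_mul _ (hh.differentiableAt hv),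
      deriv_mul_const (hg.differentiableAt hu)]
  | zero => simp
  | add F G hF' hG' hF hG =>
    have e1 : (fun t => deriv ((F + G) t) v) = fun t => deriv (F t) v + deriv (G t) v := by
      funext t
      exact deriv_add ((patch_regular hF').1 t v hv) ((patch_regular hG').1 t v hv)
    have e2 : (fun t => deriv (fun w => (F + G) w t) u) =
        fun t => deriv (fun w => F w t) u + deriv (fun w => G w t) u := by
      funext t
      exact deriv_add ((patch_regular hF').2.1 u t hu) ((patch_regular hG').2.1 u t hu)
    have oF := (patch_regular (orient_mem true hF')).2.2 v u hv hu
    have oG := (patch_regular (orient_mem true hG')).2.2 v u hv hu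
    rw [e1, e2, deriv_fun_add ((patch_regular hF').2.2 u v hu hv)
      ((patch_regular hG').2.2 u v hu hv), hF, hG]
    exact (deriv_fun_add oF oG).symm
  | smul c F hF' hF =>
    have e1 : (fun t => deriv ((c • F) t) v) = fun t => c * deriv (F t) v := by
      funext t
      exact deriv_const_mul c ((patch_regular hF').1 t v hv)
    have e2 : (fun t => deriv (fun w => (c • F) w t) u) =
        fun t => c * deriv (fun w => F w t) u := by
      funext t
      exact deriv_const_mul c ((patch_regular hF').2.1 u t hu)
    have oF := (patch_regular (orient_mem true hF')).2.2 v u hv hu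
    rw [e1, e2, deriv_const_mul c ((patch_regular hF').2.2 u v hu hv), hF]
    exact (deriv_const_mul c oF).symm

theorem taylor_orient {r k : ℕ} (i : Bool) {F : ℝ → ℝ → ℝ} (hF : F ∈ patch r k) :
    taylor (orient i F) = orientTaylor i (taylor F) := by
  have h0 : (0 : ℝ) ≠ 1 / 2 := by norm_num
  cases i
  · rfl
  · funext n
    fin_cases n
    · rfl
    · rfl
    · rfl
    · exact (patch_deriv_comm hF h0 h0).symm

/-- Functions that agree on `[0,1]` have the same derivatives there, including at the ends, as
soon as both are differentiable. -/
theorem deriv_eq_of_eqOn_Icc {a b : ℝ} {f g : ℝ → ℝ} {u : ℝ} (hab : a < b) (hu : u ∈ Icc a b)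
    (hf : DifferentiableAt ℝ f u) (hg : DifferentiableAt ℝ g u) (h : EqOn f g (Icc a b)) :
    deriv f u = deriv g u := by
  have hU := uniqueDiffOn_Icc hab u hu
  rw [← hf.derivWithin hU, ← hg.derivWithin hU]
  exact derivWithin_congr h (h hu)

/-! ### Patches that vanish to first order along a side -/

/-- The function vanishes to first order along the side `v = 0` of the unit square. -/
def FlatBelow (F : ℝ → ℝ → ℝ) : Prop := ∀ u ∈ Icc (0 : ℝ) 1, F u 0 = 0 ∧ deriv (F u) 0 = 0

theorem FlatBelow.taylor {r k : ℕ} {F : ℝ → ℝ → ℝ} (hF : F ∈ patch r k) (h : FlatBelow F) :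
    taylor F = 0 := by
  have h0 : (0 : ℝ) ≠ 1 / 2 := by norm_num
  have hm : (0 : ℝ) ∈ Icc (0 : ℝ) 1 := by simp
  have e1 : deriv (fun u => F u 0) 0 = 0 :=
    (deriv_eq_of_eqOn_Icc zero_lt_one hm ((patch_regular hF).2.1 0 0 h0)
      (differentiableAt_const (0 : ℝ)) fun u hu => (h u hu).1).trans (deriv_const _ _)
  have e2 : deriv (fun u => deriv (F u) 0) 0 = 0 :=
    (deriv_eq_of_eqOn_Icc zero_lt_one hm ((patch_regular hF).2.2 0 0 h0 h0)
      (differentiableAt_const (0 : ℝ)) fun u hu => (h u hu).2).trans (deriv_const _ _)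
  funext n
  fin_cases n
  · exact (h 0 hm).1
  · exact e1
  · exact (h 0 hm).2
  · exact e2

/-- The function `F` after the reflections `u ↦ 1 - u` and `v ↦ 1 - v`, each applied or not. -/
def reflectBy (b c : Bool) (F : ℝ → ℝ → ℝ) : ℝ → ℝ → ℝ := fun u v => F (refl b u) (refl c v)

theorem reflectBy_mem {r k : ℕ} (b c : Bool) {F : ℝ → ℝ → ℝ} (hF : F ∈ patch r k) :
    reflectBy b c F ∈ patch r k :=
  atCorner_mem (((), b, c) : Corner Unit) hF

theorem refl_mem_Icc (b : Bool) {t : ℝ} (ht : t ∈ Icc (0 : ℝ) 1) : refl b t ∈ Icc (0 : ℝ) 1 := by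
  cases b
  · exact ht
  · exact ⟨by simpa [refl] using ht.2, by simpa [refl] using ht.1⟩

theorem orient_reflectBy (i b c : Bool) (F : ℝ → ℝ → ℝ) :
    orient i (reflectBy b c F) = reflectBy (if i then c else b) (if i then b else c) (orient i F) := by
  cases i <;> rfl

theorem deriv_reflect (f : ℝ → ℝ) (u : ℝ) : deriv (fun t => f (1 - t)) u = -deriv f (1 - u) :=
  deriv_comp_const_sub f 1 u

/-- The condition at the far sides in the definition of the splines on a star. -/
def FlatFar (F : ℝ → ℝ → ℝ) : Prop := ∀ t ∈ Icc (0 : ℝ) 1, F 1 t = 0 ∧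
  deriv (fun u => F u t) 1 = 0 ∧ F t 1 = 0 ∧ deriv (fun v => F t v) 1 = 0

theorem FlatFar.orient {F : ℝ → ℝ → ℝ} (h : FlatFar F) (i : Bool) : FlatFar (orient i F) := by
  cases i
  · exact h
  · exact fun t ht => ⟨(h t ht).2.2.1, (h t ht).2.2.2, (h t ht).1, (h t ht).2.1⟩

theorem FlatFar.flatBelow {F : ℝ → ℝ → ℝ} (h : FlatFar F) (b : Bool) :
    FlatBelow (reflectBy b true F) := by
  intro u hu
  obtain ⟨-, -, h1, h2⟩ := h _ (refl_mem_Icc b hu)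
  refine ⟨by simpa [reflectBy, refl] using h1, ?_⟩
  have : reflectBy b true F u = fun t => F (refl b u) (1 - t) := by
    funext t; simp [reflectBy, refl]
  rw [this, deriv_reflect]
  simpa using h2

theorem FlatFar.taylor_reflectBy {r k : ℕ} {F : ℝ → ℝ → ℝ} (hF : F ∈ patch r k) (h : FlatFar F)
    {b c : Bool} (hbc : (b || c) = true) : taylor (reflectBy b c F) = 0 := by
  cases c
  · obtain rfl : b = true := by simpa using hbc
    have h1 := (h.orient true).flatBelow false
    have h2 := h1.taylor (reflectBy_mem _ _ (orient_mem true hF))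
    have h3 := taylor_orient true (reflectBy_mem false true (orient_mem true hF))
    rw [h2, orientTaylor_zero] at h3
    exact h3
  · exact (h.flatBelow b).taylor (reflectBy_mem _ _ hF)

/-! ### Patches with prescribed first order data along two sides -/

/-- `η₀` and `η₁` are splines with Hermite data `(1,0)` and `(0,1)` at `0` and `(0,0)` at `1`. -/
structure IsHermitePair (r k : ℕ) (η₀ η₁ : ℝ → ℝ) : Prop where
  mem₀ : IsSpline r k η₀
  mem₁ : IsSpline r k η₁
  val₀ : η₀ 0 = 1
  der₀ : deriv η₀ 0 = 0
  val₁ : η₁ 0 = 0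
  der₁ : deriv η₁ 0 = 1
  far_val₀ : η₀ 1 = 0
  far_der₀ : deriv η₀ 1 = 0
  far_val₁ : η₁ 1 = 0
  far_der₁ : deriv η₁ 1 = 0

/-- The Boolean sum of the Hermite extensions of the first order data `α` along `v = 0` and `β`
along `u = 0`: the sum of the two extensions, minus the one that interpolates the Taylor data at
the origin, which both contain. -/
def booleanSum (η₀ η₁ α₀ α₁ β₀ β₁ : ℝ → ℝ) : ℝ → ℝ → ℝ := fun u v =>
  (α₀ u * η₀ v + α₁ u * η₁ v) + (η₀ u * β₀ v + η₁ u * β₁ v)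
    - ((α₀ 0 * η₀ u + deriv α₀ 0 * η₁ u) * η₀ v + (α₁ 0 * η₀ u + deriv α₁ 0 * η₁ u) * η₁ v)

theorem booleanSum_mem {r k : ℕ} {η₀ η₁ α₀ α₁ β₀ β₁ : ℝ → ℝ} (hη : IsHermitePair r k η₀ η₁)
    (hα₀ : IsSpline r k α₀) (hα₁ : IsSpline r k α₁) (hβ₀ : IsSpline r k β₀)
    (hβ₁ : IsSpline r k β₁) : booleanSum η₀ η₁ α₀ α₁ β₀ β₁ ∈ patch r k := by
  have key : ∀ c d : ℝ, IsSpline r k (fun u => c * η₀ u + d * η₁ u) := fun c d =>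
    (splineSpace r k).add_mem ((splineSpace r k).smul_mem c hη.mem₀)
      ((splineSpace r k).smul_mem d hη.mem₁)
  exact sub_mem (add_mem (add_mem (patch_mul hα₀ hη.mem₀) (patch_mul hα₁ hη.mem₁))
    (add_mem (patch_mul hη.mem₀ hβ₀) (patch_mul hη.mem₁ hβ₁)))
    (add_mem (patch_mul (key _ _) hη.mem₀) (patch_mul (key _ _) hη.mem₁))

theorem deriv_booleanSum {r k : ℕ} {η₀ η₁ α₀ α₁ β₀ β₁ : ℝ → ℝ} (hη : IsHermitePair r k η₀ η₁)
    (hβ₀ : IsSpline r k β₀) (hβ₁ : IsSpline r k β₁) (u : ℝ) {v : ℝ} (hv : v ≠ 1 / 2) :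
    deriv (booleanSum η₀ η₁ α₀ α₁ β₀ β₁ u) v =
      (α₀ u * deriv η₀ v + α₁ u * deriv η₁ v) + (η₀ u * deriv β₀ v + η₁ u * deriv β₁ v)
      - ((α₀ 0 * η₀ u + deriv α₀ 0 * η₁ u) * deriv η₀ v
        + (α₁ 0 * η₀ u + deriv α₁ 0 * η₁ u) * deriv η₁ v) := by
  have a0 := (hη.mem₀.differentiableAt hv).hasDerivAt
  have a1 := (hη.mem₁.differentiableAt hv).hasDerivAt
  have b0 := (hβ₀.differentiableAt hv).hasDerivAt
  have b1 := (hβ₁.differentiableAt hv).hasDerivAt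
  exact ((((a0.const_mul _).add (a1.const_mul _)).add ((b0.const_mul _).add (b1.const_mul _))).sub
    ((a0.const_mul _).add (a1.const_mul _))).deriv

theorem booleanSum_orient (η₀ η₁ α₀ α₁ β₀ β₁ : ℝ → ℝ) (h₀ : β₀ 0 = α₀ 0) (h₁ : β₁ 0 = deriv α₀ 0)
    (h₂ : deriv β₀ 0 = α₁ 0) (h₃ : deriv β₁ 0 = deriv α₁ 0) :
    orient true (booleanSum η₀ η₁ α₀ α₁ β₀ β₁) = booleanSum η₀ η₁ β₀ β₁ α₀ α₁ := by
  funext u v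
  simp only [orient, booleanSum, if_true, h₀, h₁, h₂, h₃]
  ring

/-- Two patches `A` and `B` that have the same Taylor data at the origin (in exchanged
coordinates) and vanishing Taylor data at `(1,0)` provide the first order data along `v = 0` and
along `u = 0` of a patch that is flat along the other two sides. -/
theorem exists_patch_of_sides {r k : ℕ} {η₀ η₁ : ℝ → ℝ} (hη : IsHermitePair r k η₀ η₁)
    {A B : ℝ → ℝ → ℝ} (hA : A ∈ patch r k) (hB : B ∈ patch r k)
    (hAB : taylor B = orientTaylor true (taylor A))
    (hA' : taylor (reflectBy true false A) = 0) (hB' : taylor (reflectBy true false B) = 0) :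
    ∃ f ∈ patch r k, (∀ u, f u 0 = A u 0 ∧ deriv (f u) 0 = deriv (A u) 0) ∧
      (∀ u, orient true f u 0 = B u 0 ∧ deriv (orient true f u) 0 = deriv (B u) 0) ∧
      FlatFar f := by
  have h0 : (0 : ℝ) ≠ 1 / 2 := by norm_num
  have h1 : (1 : ℝ) ≠ 1 / 2 := by norm_num
  have sA₀ := (patch_traces hA).1 0
  have sA₁ := (patch_traces hA).2 0 h0
  have sB₀ := (patch_traces hB).1 0
  have sB₁ := (patch_traces hB).2 0 h0
  have t0 : B 0 0 = A 0 0 := congrFun hAB 0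
  have t1 : deriv (fun u => B u 0) 0 = deriv (A 0) 0 := congrFun hAB 1
  have t2 : deriv (B 0) 0 = deriv (fun u => A u 0) 0 := congrFun hAB 2
  have t3 : deriv (fun u => deriv (B u) 0) 0 = deriv (fun u => deriv (A u) 0) 0 := congrFun hAB 3
  have far : ∀ {C : ℝ → ℝ → ℝ}, taylor (reflectBy true false C) = 0 → C 1 0 = 0 ∧
      deriv (fun u => C u 0) 1 = 0 ∧ deriv (C 1) 0 = 0 ∧ deriv (fun u => deriv (C u) 0) 1 = 0 := by
    intro C hC
    have c0 : C (1 - 0) 0 = 0 := congrFun hC 0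
    have c1 : -deriv (fun w => C w 0) (1 - 0) = 0 :=
      (deriv_reflect (fun w => C w 0) 0).symm.trans (congrFun hC 1)
    have c2 : deriv (C (1 - 0)) 0 = 0 := congrFun hC 2
    have c3 : -deriv (fun w => deriv (C w) 0) (1 - 0) = 0 :=
      (deriv_reflect (fun w => deriv (C w) 0) 0).symm.trans (congrFun hC 3)
    simp only [sub_zero, neg_eq_zero] at c0 c1 c2 c3
    exact ⟨c0, c1, c2, c3⟩
  obtain ⟨a0, a1, a2, a3⟩ := far hA'
  obtain ⟨b0, b1, b2, b3⟩ := far hB'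
  -- The statements about the two sides `v = 0`, `v = 1` imply those about `u = 0`, `u = 1`.
  have main : ∀ {α₀ α₁ β₀ β₁ : ℝ → ℝ}, IsSpline r k β₀ → IsSpline r k β₁ → β₀ 0 = α₀ 0 →
      β₁ 0 = deriv α₀ 0 → deriv β₀ 0 = α₁ 0 → deriv β₁ 0 = deriv α₁ 0 →
      β₀ 1 = 0 → β₁ 1 = 0 → deriv β₀ 1 = 0 → deriv β₁ 1 = 0 →
      (∀ u, booleanSum η₀ η₁ α₀ α₁ β₀ β₁ u 0 = α₀ u ∧
        deriv (booleanSum η₀ η₁ α₀ α₁ β₀ β₁ u) 0 = α₁ u) ∧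
      ∀ u, booleanSum η₀ η₁ α₀ α₁ β₀ β₁ u 1 = 0 ∧
        deriv (booleanSum η₀ η₁ α₀ α₁ β₀ β₁ u) 1 = 0 := by
    intro α₀ α₁ β₀ β₁ s0 s1 e0 e1 e2 e3 f0 f1 f2 f3
    refine ⟨fun u => ⟨?_, ?_⟩, fun u => ⟨?_, ?_⟩⟩
    · simp only [booleanSum, hη.val₀, hη.val₁, e0, e1]
      ring
    · rw [deriv_booleanSum hη s0 s1 u h0, hη.der₀, hη.der₁, e2, e3]
      ring
    · simp only [booleanSum, hη.far_val₀, hη.far_val₁, f0, f1]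
      ring
    · rw [deriv_booleanSum hη s0 s1 u h1, hη.far_der₀, hη.far_der₁, f2, f3]
      ring
  obtain ⟨m1, m2⟩ := main (α₀ := fun u => A u 0) (α₁ := fun u => deriv (A u) 0) sB₀ sB₁ t0 t2 t1 t3
    b0 b2 b1 b3
  obtain ⟨n1, n2⟩ := main (α₀ := fun u => B u 0) (α₁ := fun u => deriv (B u) 0) sA₀ sA₁ t0.symm
    t1.symm t2.symm t3.symm a0 a2 a1 a3
  have ho := booleanSum_orient η₀ η₁ (fun u => A u 0) (fun u => deriv (A u) 0) (fun u => B u 0)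
    (fun u => deriv (B u) 0) t0 t2 t1 t3
  refine ⟨_, booleanSum_mem hη sA₀ sA₁ sB₀ sB₁, m1, fun u => ?_, fun t _ => ?_⟩
  · rw [ho]
    exact n1 u
  · rw [← ho] at n2
    exact ⟨(n2 t).1, (n2 t).2, (m2 t).1, (m2 t).2⟩

/-! ### Gluing conditions along one edge -/

namespace GluingData

variable {M : QuadMesh Φ} {s l : ℕ} (D : GluingData M s l)

theorem differentiableAt_fa {x y : FaceFlag Φ} (h : M.glue x = some y) :
    DifferentiableAt ℝ (D.fa x) 0 := by
  obtain ⟨ha, -, hc⟩ := D.spline x y h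
  have h0 : (0 : ℝ) ≠ 1 / 2 := by norm_num
  exact (ha.differentiableAt h0).div (hc.differentiableAt h0) (D.c_ne x y h 0 (by simp))

theorem differentiableAt_fb {x y : FaceFlag Φ} (h : M.glue x = some y) :
    DifferentiableAt ℝ (D.fb x) 0 := by
  obtain ⟨-, hb, hc⟩ := D.spline x y h
  have h0 : (0 : ℝ) ≠ 1 / 2 := by norm_num
  exact (hb.differentiableAt h0).div (hc.differentiableAt h0) (D.c_ne x y h 0 (by simp))

theorem fb_ne_zero {x y : FaceFlag Φ} (h : M.glue x = some y) {u : ℝ} (hu : u ∈ Icc (0 : ℝ) 1) :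
    D.fb x u ≠ 0 :=
  div_ne_zero (D.b_ne x y h u hu) (D.c_ne x y h u hu)

theorem fa_glue {x y : FaceFlag Φ} (h : M.glue x = some y) {u : ℝ} (hu : u ∈ Icc (0 : ℝ) 1) :
    D.fa y u = -D.fa x u / D.fb x u := by
  obtain ⟨e1, -, e3⟩ := D.inverse x y h
  have hb := D.b_ne x y h u hu
  have hc := D.c_ne x y h u hu
  simp only [fa, fb, e1, e3, Pi.neg_apply]
  field_simp

theorem fb_glue {x y : FaceFlag Φ} (h : M.glue x = some y) {u : ℝ} (hu : u ∈ Icc (0 : ℝ) 1) :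
    D.fb y u = 1 / D.fb x u := by
  obtain ⟨-, e2, e3⟩ := D.inverse x y h
  have hb := D.b_ne x y h u hu
  have hc := D.c_ne x y h u hu
  simp only [fb, e2, e3]
  field_simp

/-- The derivatives at the corner of the data of the inverse transition map. -/
theorem deriv_glue {x y : FaceFlag Φ} (h : M.glue x = some y) :
    deriv (D.fa y) 0 =
        -(deriv (D.fa x) 0 * D.fb x 0 - D.fa x 0 * deriv (D.fb x) 0) / D.fb x 0 ^ 2 ∧
      deriv (D.fb y) 0 = -deriv (D.fb x) 0 / D.fb x 0 ^ 2 := by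
  have hy := M.glue_symm x y h
  have hm : (0 : ℝ) ∈ Icc (0 : ℝ) 1 := by simp
  have da := (D.differentiableAt_fa h).hasDerivAt
  have db := (D.differentiableAt_fb h).hasDerivAt
  have hb := D.fb_ne_zero h hm
  constructor
  · refine (deriv_eq_of_eqOn_Icc zero_lt_one hm (D.differentiableAt_fa hy)
      (da.neg.div db hb).differentiableAt fun u hu => D.fa_glue h hu).trans ?_
    rw [(da.neg.div db hb).deriv]
    simp only [Pi.neg_apply]
    ring
  · refine (deriv_eq_of_eqOn_Icc zero_lt_one hm (D.differentiableAt_fb hy)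
      ((hasDerivAt_const (0 : ℝ) (1 : ℝ)).div db hb).differentiableAt
      fun u hu => D.fb_glue h hu).trans ?_
    rw [((hasDerivAt_const (0 : ℝ) (1 : ℝ)).div db hb).deriv]
    ring

theorem edgeTaylorSpace_glue {x y : FaceFlag Φ} (h : M.glue x = some y) {p q : Fin 4 → ℝ}
    (hpq : (p, q) ∈ D.edgeTaylorSpace x) : (q, p) ∈ D.edgeTaylorSpace y := by
  have hm : (0 : ℝ) ∈ Icc (0 : ℝ) 1 := by simp
  have hb := D.fb_ne_zero h hm
  obtain ⟨h0, h1, h2, ρ, h3⟩ := hpq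
  obtain ⟨d1, d2⟩ := D.deriv_glue h
  simp only at h0 h1 h2 h3
  refine ⟨h0.symm, h1.symm, ?_, ρ, ?_⟩
  · simp only [D.fa_glue h hm, D.fb_glue h hm, h2, h1]
    field_simp
    ring
  · simp only [D.fa_glue h hm, D.fb_glue h hm, d1, d2, h3, h2, h1]
    field_simp
    ring

theorem edgeSplines_glue {x y : FaceFlag Φ} (h : M.glue x = some y) {r k : ℕ}
    {F G : ℝ → ℝ → ℝ} (hFG : (F, G) ∈ D.edgeSplines r k x) : (G, F) ∈ D.edgeSplines r k y := by
  obtain ⟨hF, hG, hc⟩ := hFG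
  refine ⟨hG, hF, fun u hu => ⟨(hc u hu).1.symm, fun hne => ?_⟩⟩
  have hb := D.fb_ne_zero h hu
  have e : deriv (fun t => F t 0) u = deriv (fun t => G t 0) u :=
    deriv_eq_of_eqOn_Icc zero_lt_one hu ((patch_regular hF).2.1 u 0 hne)
      ((patch_regular hG).2.1 u 0 hne) fun t ht => (hc t ht).1
  have e' := (hc u hu).2 hne
  simp only at e' ⊢
  rw [D.fa_glue h hu, D.fb_glue h hu, e, e']
  field_simp
  ring

theorem edgeSplines_flip {x y : FaceFlag Φ} (h : M.glue x = some y) {r k : ℕ}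
    {F G : ℝ → ℝ → ℝ} (hFG : (F, G) ∈ D.edgeSplines r k x) :
    (reflectBy true false F, reflectBy true false G) ∈ D.edgeSplines r k x.flip := by
  obtain ⟨hF, hG, hc⟩ := hFG
  refine ⟨reflectBy_mem _ _ hF, reflectBy_mem _ _ hG, fun u hu => ?_⟩
  have hu' : 1 - u ∈ Icc (0 : ℝ) 1 := ⟨by linarith [hu.2], by linarith [hu.1]⟩
  obtain ⟨c1, c2⟩ := hc (1 - u) hu'
  refine ⟨c1, fun hne => ?_⟩
  obtain ⟨ra, rb, rc⟩ := D.reverse x y h u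
  have e1 : D.fa x.flip u = -D.fa x (1 - u) := by
    simp only [fa, ra, rc]
    ring
  have e2 : D.fb x.flip u = D.fb x (1 - u) := by
    simp only [fb, rb, rc]
  have e3 : deriv (fun t => reflectBy true false G t 0) u = -deriv (fun t => G t 0) (1 - u) :=
    deriv_reflect (fun t => G t 0) u
  rw [e1, e2]
  simp only at c2 ⊢
  rw [e3, neg_mul_neg]
  exact c2 fun h' => hne (by linarith)

theorem edgeSplines_mono {r k k' : ℕ} (h : k ≤ k') (x : FaceFlag Φ) :
    D.edgeSplines r k x ≤ D.edgeSplines r k' x :=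
  fun _ hP => ⟨patch_mono h hP.1, patch_mono h hP.2.1, hP.2.2⟩

/-- The gluing condition only involves the values and the normal derivatives along the edge. -/
theorem edgeSplines_congr {r k : ℕ} {x : FaceFlag Φ} {F G F' G' : ℝ → ℝ → ℝ}
    (hFG : (F, G) ∈ D.edgeSplines r k x) (hF' : F' ∈ patch r k) (hG' : G' ∈ patch r k)
    (hF : ∀ u, F' u 0 = F u 0 ∧ deriv (F' u) 0 = deriv (F u) 0)
    (hG : ∀ u, G' u 0 = G u 0 ∧ deriv (G' u) 0 = deriv (G u) 0) :
    (F', G') ∈ D.edgeSplines r k x := by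
  refine ⟨hF', hG', fun u hu => ⟨?_, fun hne => ?_⟩⟩
  · exact (hF u).1.trans (((hFG.2.2 u hu).1).trans (hG u).1.symm)
  · have e : (fun t => G' t 0) = fun t => G t 0 := funext fun t => (hG t).1
    have := (hFG.2.2 u hu).2 hne
    simp only at this ⊢
    rw [e, (hF u).2, (hG u).2, this]

theorem edgeSplines_of_flatBelow {r k : ℕ} (x : FaceFlag Φ) {F G : ℝ → ℝ → ℝ}
    (hF : F ∈ patch r k) (hG : G ∈ patch r k) (hF' : FlatBelow F) (hG' : FlatBelow G) :
    (F, G) ∈ D.edgeSplines r k x := by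
  refine ⟨hF, hG, fun u hu => ⟨(hF' u hu).1.trans (hG' u hu).1.symm, fun hne => ?_⟩⟩
  have e : deriv (fun t => G t 0) u = 0 :=
    (deriv_eq_of_eqOn_Icc zero_lt_one hu ((patch_regular hG).2.1 u 0 hne)
      (differentiableAt_const (0 : ℝ)) fun t ht => (hG' t ht).1).trans (deriv_const _ _)
  simp only
  rw [e, (hF' u hu).2, (hG' u hu).2]
  ring

/-- The relations between Taylor data follow from the gluing conditions: the value, the tangential
derivative and the first two terms of the expansion along the edge of the second condition. -/
theorem taylor_mem_edgeTaylorSpace {x y : FaceFlag Φ} (h : M.glue x = some y) {r k : ℕ}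
    {F G : ℝ → ℝ → ℝ} (hFG : (F, G) ∈ D.edgeSplines r k x) :
    (taylor F, taylor G) ∈ D.edgeTaylorSpace x := by
  obtain ⟨hF, hG, hc⟩ := hFG
  have h0 : (0 : ℝ) ≠ 1 / 2 := by norm_num
  have hm : (0 : ℝ) ∈ Icc (0 : ℝ) 1 := by simp
  have e1 : deriv (fun t => F t 0) 0 = deriv (fun t => G t 0) 0 :=
    deriv_eq_of_eqOn_Icc zero_lt_one hm ((patch_regular hF).2.1 0 0 h0)
      ((patch_regular hG).2.1 0 0 h0) fun t ht => (hc t ht).1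
  have e2 := (hc 0 hm).2 h0
  -- The tangential derivative of a spline is a polynomial near the corner.
  have d2 : DifferentiableAt ℝ (fun u => deriv (fun t => G t 0) u) 0 := by
    obtain ⟨-, ⟨p, -, hp⟩, -⟩ := (patch_traces hG).1 0
    refine (p.derivative.differentiable.differentiableAt (x := (0 : ℝ))).congr_of_eventuallyEq ?_
    filter_upwards [Iio_mem_nhds (show (0 : ℝ) < 1 / 2 by norm_num)] with u hu
    rw [← p.deriv]
    refine Filter.EventuallyEq.deriv_eq ?_
    filter_upwards [Iio_mem_nhds hu] with t ht using hp t (le_of_lt ht)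
  have dF := (patch_regular hF).2.2 0 0 h0 h0
  have dG := ((patch_regular hG).2.2 0 0 h0 h0).hasDerivAt
  have da := (D.differentiableAt_fa h).hasDerivAt
  have db := (D.differentiableAt_fb h).hasDerivAt
  have dR := (db.mul dG).add (da.mul d2.hasDerivAt)
  have e3 : deriv (fun u => deriv (F u) 0) 0 = _ :=
    (deriv_eq_of_eqOn_Icc (show (0 : ℝ) < 1 / 4 by norm_num)
      (show (0 : ℝ) ∈ Icc (0 : ℝ) (1 / 4) by norm_num) dF dR.differentiableAt fun u hu =>
        (hc u ⟨hu.1, by linarith [hu.2]⟩).2 (by linarith [hu.2] : u < 1 / 2).ne).trans dR.deriv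
  refine ⟨(hc 0 hm).1, e1, ?_, deriv (fun u => deriv (fun t => G t 0) u) 0 / 2, ?_⟩
  · exact e2.trans (add_comm _ _)
  · refine e3.trans ?_
    simp only [taylor]
    simp
    ring

theorem IsSeparated.mono {D : GluingData M s l} {r k k' : ℕ} {x : FaceFlag Φ}
    (hx : D.IsSeparated r k x) (h : k ≤ k') : D.IsSeparated r k' x := by
  refine ⟨fun hs => ?_, fun hn => ?_⟩
  · obtain ⟨y, hy⟩ := Option.isSome_iff_exists.1 hs
    apply Subset.antisymm
    · rintro _ ⟨⟨F, G⟩, hP, rfl⟩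
      have hf : M.glue x.flip = some y.flip := by rw [M.glue_flip, hy]; rfl
      exact ⟨D.taylor_mem_edgeTaylorSpace hy hP,
        D.taylor_mem_edgeTaylorSpace hf (D.edgeSplines_flip hy hP)⟩
    · rw [← hx.1 hs]
      exact image_mono (D.edgeSplines_mono h x)
  · rw [eq_univ_iff_forall]
    intro t
    obtain ⟨F, hF, e⟩ := (eq_univ_iff_forall.1 (hx.2 hn)) t
    exact ⟨F, patch_mono h hF, e⟩

theorem isSeparated_of_separability_le {r k : ℕ} {x : FaceFlag Φ} (h : D.separability r x ≤ k) :
    D.IsSeparated r k x := by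
  by_contra hk
  have : ((k + 1 : ℕ) : ℕ∞) ≤ D.separability r x := by
    refine le_iInf₂ fun m hm => ?_
    have : ¬ m ≤ k := fun h' => hk (hm.mono h')
    exact_mod_cast (by omega : k + 1 ≤ m)
  have := this.trans h
  norm_cast at this
  omega

/-- A separated shared edge carries a spline with given Taylor data at one end and zero Taylor data
at the other. -/
theorem IsSeparated.exists_pair {D : GluingData M s l} {r k : ℕ} {x y : FaceFlag Φ}
    (hx : D.IsSeparated r k x) (h : M.glue x = some y) {p q : Fin 4 → ℝ}
    (hpq : (p, q) ∈ D.edgeTaylorSpace x) :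
    ∃ F G, (F, G) ∈ D.edgeSplines r k x ∧ taylor F = p ∧ taylor G = q ∧
      taylor (reflectBy true false F) = 0 ∧ taylor (reflectBy true false G) = 0 := by
  have hm : ((p, q), ((0 : Fin 4 → ℝ), (0 : Fin 4 → ℝ))) ∈
      (D.edgeTaylorSpace x : Set ((Fin 4 → ℝ) × (Fin 4 → ℝ))) ×ˢ
      (D.edgeTaylorSpace x.flip : Set ((Fin 4 → ℝ) × (Fin 4 → ℝ))) :=
    ⟨hpq, (D.edgeTaylorSpace x.flip).zero_mem⟩
  rw [← hx.1 (by simp [h])] at hm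
  obtain ⟨⟨F, G⟩, hP, e⟩ := hm
  simp only [Prod.mk.injEq] at e
  exact ⟨F, G, hP, e.1.1, e.1.2, e.2.1, e.2.2⟩

theorem IsSeparated.exists_patch {D : GluingData M s l} {r k : ℕ} {x : FaceFlag Φ}
    (hx : D.IsSeparated r k x) (h : M.glue x = none) (p : Fin 4 → ℝ) :
    ∃ F ∈ patch r k, taylor F = p ∧ taylor (reflectBy true false F) = 0 := by
  obtain ⟨F, hF, e⟩ := (eq_univ_iff_forall.1 (hx.2 h)) (p, 0)
  simp only [Prod.mk.injEq] at e
  exact ⟨F, hF, e.1, e.2⟩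

theorem IsSeparated.exists_hermitePair {D : GluingData M s l} {r k : ℕ} {x : FaceFlag Φ}
    (hx : D.IsSeparated r k x) : ∃ η₀ η₁, IsHermitePair r k η₀ η₁ := by
  -- The traces on the edge of two splines whose values and tangential derivatives are prescribed.
  obtain ⟨⟨F, hF, p0, p1, pz⟩, G, hG, q0, q1, qz⟩ :
      (∃ F ∈ patch r k, taylor F 0 = 1 ∧ taylor F 1 = 0 ∧ taylor (reflectBy true false F) = 0) ∧
      ∃ F ∈ patch r k, taylor F 0 = 0 ∧ taylor F 1 = 1 ∧ taylor (reflectBy true false F) = 0 := by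
    rcases h : M.glue x with _ | y
    · obtain ⟨F, hF, e, e'⟩ := hx.exists_patch h ![1, 0, 0, 0]
      obtain ⟨G, hG, d, d'⟩ := hx.exists_patch h ![0, 1, 0, 0]
      exact ⟨⟨F, hF, by simp [e], by simp [e], e'⟩, G, hG, by simp [d], by simp [d], d'⟩
    · have m1 : ((![1, 0, 0, 0] : Fin 4 → ℝ), (![1, 0, 0, 0] : Fin 4 → ℝ)) ∈
          D.edgeTaylorSpace x := ⟨rfl, rfl, by simp, 0, by simp⟩
      have m2 : ((![0, 1, D.fa x 0, deriv (D.fa x) 0] : Fin 4 → ℝ),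
          (![0, 1, 0, 0] : Fin 4 → ℝ)) ∈ D.edgeTaylorSpace x := ⟨rfl, rfl, by simp, 0, by simp⟩
      obtain ⟨F, _, hF, e, -, e', -⟩ := hx.exists_pair h m1
      obtain ⟨G, _, hG, d, -, d', -⟩ := hx.exists_pair h m2
      exact ⟨⟨F, hF.1, by simp [e], by simp [e], e'⟩, G, hG.1, by simp [d], by simp [d], d'⟩
  have far : ∀ {C : ℝ → ℝ → ℝ}, taylor (reflectBy true false C) = 0 → C 1 0 = 0 ∧
      deriv (fun u => C u 0) 1 = 0 := by
    intro C hC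
    have c0 : C (1 - 0) 0 = 0 := congrFun hC 0
    have c1 : -deriv (fun w => C w 0) (1 - 0) = 0 :=
      (deriv_reflect (fun w => C w 0) 0).symm.trans (congrFun hC 1)
    simp only [sub_zero, neg_eq_zero] at c0 c1
    exact ⟨c0, c1⟩
  exact ⟨_, _, (patch_traces hF).1 0, (patch_traces hG).1 0, p0, p1, q0, q1, (far pz).1,
    (far pz).2, (far qz).1, (far qz).2⟩

/-- Splines along all the separated edges of a set of flags closed under gluing: `A x` is the part
on the face of `x` of the spline along the edge of `x`. -/
theorem exists_sides {r k : ℕ} (S : Set (FaceFlag Φ)) (hS : ∀ x ∈ S, D.IsSeparated r k x)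
    (t : FaceFlag Φ → Fin 4 → ℝ)
    (ht : ∀ x ∈ S, ∀ y, M.glue x = some y → y ∈ S ∧ (t x, t y) ∈ D.edgeTaylorSpace x) :
    ∃ A : FaceFlag Φ → ℝ → ℝ → ℝ, ∀ x ∈ S, A x ∈ patch r k ∧ taylor (A x) = t x ∧
      taylor (reflectBy true false (A x)) = 0 ∧
      ∀ y, M.glue x = some y → (A x, A y) ∈ D.edgeSplines r k x := by
  have key : ∀ x : FaceFlag Φ, ∃ F G : ℝ → ℝ → ℝ, x ∈ S →
      (M.glue x = none → F ∈ patch r k ∧ taylor F = t x ∧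
        taylor (reflectBy true false F) = 0) ∧
      ∀ y, M.glue x = some y → (F, G) ∈ D.edgeSplines r k x ∧ taylor F = t x ∧
        taylor G = t y ∧ taylor (reflectBy true false F) = 0 ∧
        taylor (reflectBy true false G) = 0 := by
    intro x
    by_cases hx : x ∈ S
    · rcases h : M.glue x with _ | y
      · obtain ⟨F, hF, e, e'⟩ := (hS x hx).exists_patch h (t x)
        exact ⟨F, 0, fun _ => ⟨fun _ => ⟨hF, e, e'⟩, by simp⟩⟩
      · obtain ⟨F, G, hFG, e⟩ := (hS x hx).exists_pair h (ht x hx y h).2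
        refine ⟨F, G, fun _ => ⟨by simp, fun z hz => ?_⟩⟩
        obtain rfl : y = z := by simpa using hz
        exact ⟨hFG, e⟩
    · exact ⟨0, 0, fun h => absurd h hx⟩
  choose F G hFG using key
  -- The splines chosen for the two flags of an edge may differ; their mean does not.
  refine ⟨fun x => match M.glue x with
    | none => F x
    | some y => (1 / 2 : ℝ) • (F x + G y), fun x hx => ?_⟩
  rcases h : M.glue x with _ | y
  · obtain ⟨hF, e, e'⟩ := (hFG x hx).1 h
    refine ⟨by simpa [h] using hF, by simpa [h] using e, by simpa [h] using e', by simp [h]⟩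
  · have h' := M.glue_symm x y h
    obtain ⟨m1, e1, e2, z1, z2⟩ := (hFG x hx).2 y h
    obtain ⟨m2, d1, d2, w1, w2⟩ := (hFG y (ht x hx y h).1).2 x h'
    have hA : (F x + G y) ∈ patch r k := add_mem m1.1 m2.2.1
    simp only [h]
    refine ⟨Submodule.smul_mem _ _ hA, ?_, ?_, fun z hz => ?_⟩
    · rw [taylor_smul _ hA, taylor_add m1.1 m2.2.1, e1, d2]
      funext n
      simp only [Pi.smul_apply, Pi.add_apply, smul_eq_mul]
      ring
    · have : reflectBy true false ((1 / 2 : ℝ) • (F x + G y)) =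
          (1 / 2 : ℝ) • (reflectBy true false (F x) + reflectBy true false (G y)) := rfl
      rw [this, taylor_smul _ (add_mem (reflectBy_mem _ _ m1.1) (reflectBy_mem _ _ m2.2.1)),
        taylor_add (reflectBy_mem _ _ m1.1) (reflectBy_mem _ _ m2.2.1), z1, w2]
      simp
    · obtain rfl : y = z := by simpa using hz
      simp only [h']
      have := (D.edgeSplines r k x).smul_mem (1 / 2 : ℝ)
        ((D.edgeSplines r k x).add_mem m1 (D.edgeSplines_glue h' m2))
      rw [Prod.mk_add_mk, Prod.smul_mk, add_comm (G x)] at this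
      exact this

end GluingData

/-! ### The ranges of the Taylor maps -/

theorem QuadMesh.vertex_eq_of_glue {M : QuadMesh Φ} {x y : FaceFlag Φ} (h : M.glue x = some y) :
    M.vertex x.1 = M.vertex y.1 :=
  Quot.sound ⟨x.2, y.2, h⟩

/-- A corner as a corner at its vertex. -/
def QuadMesh.cornerAt (M : QuadMesh Φ) {γ : M.Vertex} (κ : Corner Φ) (h : M.vertex κ = γ) :
    M.CornersAt γ := Subtype.mk κ h

theorem taylor_congr {F G : ℝ → ℝ → ℝ} (h : ∀ u, F u 0 = G u 0 ∧ deriv (F u) 0 = deriv (G u) 0) :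
    taylor F = taylor G := by
  have e1 : (fun u => F u 0) = fun u => G u 0 := funext fun u => (h u).1
  have e2 : (fun u => deriv (F u) 0) = fun u => deriv (G u) 0 := funext fun u => (h u).2
  simp only [taylor, e1, e2, (h 0).1, (h 0).2]

namespace GluingData

variable {M : QuadMesh Φ} {s l : ℕ} (D : GluingData M s l)

theorem range_vertexTaylorMap {r k : ℕ} {γ : M.Vertex}
    (hsep : ∀ x : FaceFlag Φ, M.vertex x.1 = γ → D.IsSeparated r k x) :
    LinearMap.range (D.vertexTaylorMap r k γ) = D.taylorSpace γ := by
  apply le_antisymm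
  · rintro _ ⟨⟨f, hf⟩, rfl⟩ κ μ i j h
    have := D.taylor_mem_edgeTaylorSpace h (hf.2.1 κ μ i j h)
    rwa [taylor_orient i (hf.1 κ), taylor_orient j (hf.1 μ)] at this
  · intro h hh
    classical
    let t : FaceFlag Φ → Fin 4 → ℝ := fun x =>
      if hx : M.vertex x.1 = γ then orientTaylor x.2 (h (M.cornerAt x.1 hx)) else 0
    have tκ : ∀ (κ : M.CornersAt γ) i, t (κ.1, i) = orientTaylor i (h κ) :=
      fun κ i => dif_pos κ.2
    obtain ⟨A, hA⟩ := D.exists_sides (r := r) (k := k) {x | M.vertex x.1 = γ} hsep t (by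
      rintro ⟨κ, i⟩ hx ⟨μ, j⟩ hxy
      have hy : M.vertex μ = γ := (QuadMesh.vertex_eq_of_glue hxy).symm.trans hx
      refine ⟨hy, ?_⟩
      rw [show t (κ, i) = _ from tκ (M.cornerAt κ hx) i,
        show t (μ, j) = _ from tκ (M.cornerAt μ hy) j]
      exact hh (M.cornerAt κ hx) (M.cornerAt μ hy) i j hxy)
    have key : ∀ κ : M.CornersAt γ, ∃ f ∈ patch r k,
        (∀ i u, orient i f u 0 = A (κ.1, i) u 0 ∧
          deriv (orient i f u) 0 = deriv (A (κ.1, i) u) 0) ∧ FlatFar f := by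
      intro κ
      obtain ⟨a0, a1, a2, -⟩ := hA (κ.1, false) κ.2
      obtain ⟨b0, b1, b2, -⟩ := hA (κ.1, true) κ.2
      obtain ⟨η₀, η₁, hη⟩ := (hsep (κ.1, false) κ.2).exists_hermitePair
      obtain ⟨f, hf, f1, f2, f3⟩ := exists_patch_of_sides hη a0 b0
        (by rw [a1, b1, tκ, tκ]; rfl) a2 b2
      refine ⟨f, hf, fun i => ?_, f3⟩
      cases i
      · exact f1
      · exact f2
    choose f hf hfj hff using key
    refine ⟨⟨f, hf, fun κ μ i j hg => ?_, hff⟩, ?_⟩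
    · exact D.edgeSplines_congr ((hA (κ.1, i) κ.2).2.2.2 _ hg) (orient_mem i (hf κ))
        (orient_mem j (hf μ)) (hfj κ i) (hfj μ j)
    · funext κ
      refine (taylor_congr (hfj κ false)).trans ?_
      rw [(hA (κ.1, false) κ.2).2.1, tκ]
      rfl

/-- The function on a face assembled from functions `G κ` attached to its corners `κ`, each given
in coordinates with `κ` at the origin. -/
def assemble (G : Corner Φ → ℝ → ℝ → ℝ) (σ : Φ) : ℝ → ℝ → ℝ :=
  (atCorner (σ, false, false) (G (σ, false, false)) + atCorner (σ, true, false) (G (σ, true, false)))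
    + (atCorner (σ, false, true) (G (σ, false, true)) + atCorner (σ, true, true) (G (σ, true, true)))

theorem atCorner_assemble (G : Corner Φ → ℝ → ℝ → ℝ) (κ : Corner Φ) :
    atCorner κ (assemble G κ.1) =
      (G κ + reflectBy true false (G (κ.1, !κ.2.1, κ.2.2))) +
        (reflectBy false true (G (κ.1, κ.2.1, !κ.2.2)) +
          reflectBy true true (G (κ.1, !κ.2.1, !κ.2.2))) := by
  obtain ⟨σ, b, c⟩ := κ
  funext u v
  cases b <;> cases c <;>
    simp [atCorner, assemble, reflectBy, refl] <;> ring

/-- In the coordinates of a flag `x` the assembled function consists, to first order along the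
side of `x`, of the functions attached to the two ends of that side. -/
theorem orient_atCorner_assemble {r k : ℕ} (G : Corner Φ → ℝ → ℝ → ℝ) (hG : ∀ κ, G κ ∈ patch r k)
    (hG' : ∀ κ, FlatFar (G κ)) (x : FaceFlag Φ) :
    ∃ Z Z' : ℝ → ℝ → ℝ, (Z ∈ patch r k ∧ FlatBelow Z) ∧ (Z' ∈ patch r k ∧ FlatBelow Z') ∧
      orient x.2 (atCorner x.1 (assemble G x.1.1)) =
        (orient x.2 (G x.1) + reflectBy true false (orient x.flip.2 (G x.flip.1))) + (Z + Z') := by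
  obtain ⟨⟨σ, b, c⟩, i⟩ := x
  rw [atCorner_assemble]
  have hm : ∀ d κ, reflectBy d true (orient i (G κ)) ∈ patch r k ∧
      FlatBelow (reflectBy d true (orient i (G κ))) := fun d κ =>
    ⟨reflectBy_mem _ _ (orient_mem i (hG κ)), ((hG' κ).orient i).flatBelow d⟩
  cases i
  · exact ⟨_, _, hm false (σ, b, !c), hm true (σ, !b, !c), rfl⟩
  · refine ⟨_, _, hm false (σ, !b, c), hm true (σ, !b, !c), ?_⟩
    simp only [orient_add, orient_reflectBy, FaceFlag.flip, if_true]
    abel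

theorem range_taylorMap {r k : ℕ} (hsep : ∀ x : FaceFlag Φ, D.IsSeparated r k x) :
    LinearMap.range (D.taylorMap r k) = Submodule.pi Set.univ (fun γ => D.taylorSpace γ) := by
  apply le_antisymm
  · rintro _ ⟨⟨f, hf⟩, rfl⟩
    refine (Submodule.mem_pi).2 fun γ _ κ μ i j h => ?_
    have := D.taylor_mem_edgeTaylorSpace h (hf.2 κ.1 μ.1 i j h)
    rwa [taylor_orient i (atCorner_mem κ.1 (hf.1 _)),
      taylor_orient j (atCorner_mem μ.1 (hf.1 _))] at this
  · intro h hh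
    have key : ∀ γ, ∃ g ∈ D.vertexSplines r k γ, ∀ κ, taylor (g κ) = h γ κ := by
      intro γ
      have hγ : h γ ∈ LinearMap.range (D.vertexTaylorMap r k γ) := by
        rw [D.range_vertexTaylorMap fun x _ => hsep x]
        exact (Submodule.mem_pi).1 hh γ trivial
      obtain ⟨⟨g, hg⟩, e⟩ := hγ
      exact ⟨g, hg, fun κ => congrFun e κ⟩
    choose g hg hgh using key
    let G : Corner Φ → ℝ → ℝ → ℝ := fun κ => g (M.vertex κ) (M.cornerAt κ rfl)
    have Gκ : ∀ {γ : M.Vertex} (κ : M.CornersAt γ), G κ.1 = g γ κ := by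
      rintro γ ⟨κ, rfl⟩
      rfl
    have hG : ∀ κ, G κ ∈ patch r k := fun κ => (hg _).1 _
    have hG' : ∀ κ, FlatFar (G κ) := fun κ => (hg _).2.2 _
    have hedge : ∀ {x y : FaceFlag Φ}, M.glue x = some y →
        (orient x.2 (G x.1), orient y.2 (G y.1)) ∈ D.edgeSplines r k x := by
      intro x y hxy
      have hv := (QuadMesh.vertex_eq_of_glue hxy).symm
      rw [show G x.1 = _ from Gκ (M.cornerAt x.1 rfl),
        show G y.1 = _ from Gκ (M.cornerAt y.1 hv)]
      exact (hg _).2.1 (M.cornerAt x.1 rfl) (M.cornerAt y.1 hv) x.2 y.2 hxy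
    have hmem : ∀ σ, assemble G σ ∈ patch r k := fun σ =>
      add_mem (add_mem (atCorner_mem _ (hG _)) (atCorner_mem _ (hG _)))
        (add_mem (atCorner_mem _ (hG _)) (atCorner_mem _ (hG _)))
    refine ⟨⟨assemble G, hmem, fun κ μ i j hxy => ?_⟩, ?_⟩
    · obtain ⟨Z, Z', hZ, hZ', e⟩ := orient_atCorner_assemble G hG hG' (κ, i)
      obtain ⟨W, W', hW, hW', e'⟩ := orient_atCorner_assemble G hG hG' (μ, j)
      simp only at e e'
      rw [e, e']
      have hfl : M.glue (FaceFlag.flip (κ, i)) = some (FaceFlag.flip (μ, j)) := by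
        rw [M.glue_flip, hxy]; rfl
      have m2 := D.edgeSplines_flip hfl (hedge hfl)
      rw [show (FaceFlag.flip (FaceFlag.flip (κ, i))) = (κ, i) by
        cases i <;> simp [FaceFlag.flip]] at m2
      exact add_mem (add_mem (hedge hxy) m2)
        (add_mem (D.edgeSplines_of_flatBelow _ hZ.1 hW.1 hZ.2 hW.2)
          (D.edgeSplines_of_flatBelow _ hZ'.1 hW'.1 hZ'.2 hW'.2))
    · funext γ κ
      refine Eq.trans ?_ (hgh γ κ)
      change taylor (atCorner κ.1 (assemble G κ.1.1)) = _
      have hr : ∀ b c κ, reflectBy b c (G κ) ∈ patch r k := fun b c κ => reflectBy_mem b c (hG κ)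
      rw [atCorner_assemble, taylor_add (add_mem (hG _) (hr _ _ _)) (add_mem (hr _ _ _) (hr _ _ _)),
        taylor_add (hG _) (hr _ _ _), taylor_add (hr _ _ _) (hr _ _ _),
        (hG' _).taylor_reflectBy (hG _) rfl, (hG' _).taylor_reflectBy (hG _) rfl,
        (hG' _).taylor_reflectBy (hG _) rfl, Gκ]
      simp

end GluingData

/-! ### The fan of faces around a vertex -/

theorem FaceFlag.swap_swap (x : FaceFlag Φ) : x.swap.swap = x := by
  simp [FaceFlag.swap]

theorem FaceFlag.swap_ne (x : FaceFlag Φ) : x.swap ≠ x := by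
  obtain ⟨κ, i⟩ := x
  cases i <;> simp [FaceFlag.swap]

theorem FaceFlag.eq_or_eq_swap {x y : FaceFlag Φ} (h : x.1 = y.1) : x = y ∨ x = y.swap := by
  obtain ⟨κ, i⟩ := x
  obtain ⟨μ, j⟩ := y
  obtain rfl : κ = μ := h
  cases i <;> cases j <;> simp [FaceFlag.swap]

namespace QuadMesh

variable {M : QuadMesh Φ}

theorem glue_unique {x y z : FaceFlag Φ} (h : M.glue x = some z) (h' : M.glue y = some z) :
    x = y :=
  Option.some_injective _ ((M.glue_symm x z h).symm.trans (M.glue_symm y z h'))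

/-- The coordinate systems `z 0, …, z n` run once through all the faces around the vertex `γ`,
each being adjacent to the next one. Either the first and the last face have a boundary edge at
`γ`, or the last face is adjacent to the first one. -/
structure IsFan (M : QuadMesh Φ) (γ : M.Vertex) (n : ℕ) (z : ℕ → FaceFlag Φ) : Prop where
  step : ∀ i < n, M.glue (z i) = some (z (i + 1)).swap
  inj : ∀ i ≤ n, ∀ j ≤ n, (z i).1 = (z j).1 → i = j
  mem_iff : ∀ κ, M.vertex κ = γ ↔ ∃ i ≤ n, (z i).1 = κ
  close : (M.glue (z n) = none ∧ M.glue (z 0).swap = none) ∨ M.glue (z n) = some (z 0).swap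

/-- A sequence of adjacent faces never turns back: otherwise the turning point would be a side
glued to itself, or a face with only one side at the vertex. -/
theorem ne_swap_of_step {n : ℕ} {z : ℕ → FaceFlag Φ}
    (hz : ∀ i < n, M.glue (z i) = some (z (i + 1)).swap) :
    ∀ d i, i + d ≤ n → z i ≠ (z (i + d)).swap := by
  intro d
  induction d using Nat.strong_induction_on with
  | _ d ih =>
    intro i hi h
    match d, ih with
    | 0, _ => exact (FaceFlag.swap_ne _) h.symm
    | 1, _ =>
      have := hz i (by omega)
      rw [← h] at this
      exact M.glue_ne _ _ this rfl
    | d + 2, ih =>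
      have h1 := hz (i + d + 1) (by omega)
      rw [show i + d + 1 + 1 = i + (d + 2) by ring, ← h] at h1
      have h2 := (M.glue_symm _ _ h1).symm.trans (hz i (by omega))
      refine ih d (by omega) (i + 1) (by omega) ?_
      have h3 : z (i + d + 1) = (z (i + 1)).swap := Option.some_injective _ h2
      rw [show i + 1 + d = i + d + 1 by ring, h3, FaceFlag.swap_swap]

/-- A sequence of adjacent faces that returns to a face returns to the first one. -/
theorem eq_zero_of_eq {n : ℕ} {z : ℕ → FaceFlag Φ}
    (hz : ∀ i < n, M.glue (z i) = some (z (i + 1)).swap) :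
    ∀ i d, i + d ≤ n → z i = z (i + d) → z 0 = z d := by
  intro i d
  induction i with
  | zero => simp
  | succ i ih =>
    intro hi h
    refine ih (by omega) (glue_unique (hz i (by omega)) ?_)
    rw [h, show i + 1 + d = i + d + 1 by ring]
    exact hz (i + d) (by omega)

theorem vertex_of_step {n : ℕ} {z : ℕ → FaceFlag Φ}
    (hz : ∀ i < n, M.glue (z i) = some (z (i + 1)).swap) :
    ∀ i ≤ n, M.vertex (z i).1 = M.vertex (z 0).1 := by
  intro i
  induction i with
  | zero => simp
  | succ i ih =>
    intro hi
    rw [← ih (by omega)]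
    exact (vertex_eq_of_glue (hz i (by omega))).symm

/-- In a closed sequence of adjacent faces every flag is one of the sequence, or glued to one of
the sequence, or the side on the boundary at the start. -/
theorem flag_cases {n : ℕ} {z : ℕ → FaceFlag Φ}
    (hz : ∀ i < n, M.glue (z i) = some (z (i + 1)).swap)
    (hc : (M.glue (z n) = none ∧ M.glue (z 0).swap = none) ∨ M.glue (z n) = some (z 0).swap)
    {x : FaceFlag Φ} {i : ℕ} (hi : i ≤ n) (hx : (z i).1 = x.1) :
    (∃ i ≤ n, x = z i) ∨ (∃ i ≤ n, M.glue (z i) = some x) ∨ M.glue x = none := by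
  rcases FaceFlag.eq_or_eq_swap hx.symm with h | h
  · exact Or.inl ⟨i, hi, h⟩
  · right
    rcases i with _ | i
    · rcases hc with hc | hc
      · exact Or.inr (h ▸ hc.2)
      · exact Or.inl ⟨n, le_rfl, h ▸ hc⟩
    · exact Or.inl ⟨i, by omega, h ▸ hz i (by omega)⟩

theorem isFan_of_step {n : ℕ} {z : ℕ → FaceFlag Φ}
    (hz : ∀ i < n, M.glue (z i) = some (z (i + 1)).swap)
    (hne : ∀ d, 0 < d → d ≤ n → z 0 ≠ z d)
    (hc : (M.glue (z n) = none ∧ M.glue (z 0).swap = none) ∨ M.glue (z n) = some (z 0).swap) :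
    M.IsFan (M.vertex (z 0).1) n z := by
  refine ⟨hz, ?_, fun κ => ⟨fun hκ => ?_, ?_⟩, hc⟩
  · have key : ∀ i j, i < j → j ≤ n → (z i).1 ≠ (z j).1 := by
      intro i j hij hj h
      obtain ⟨d, rfl⟩ := Nat.exists_eq_add_of_lt hij
      rcases FaceFlag.eq_or_eq_swap h with h | h
      · exact hne (d + 1) (by omega) (by omega) (eq_zero_of_eq hz i (d + 1) hj h)
      · exact ne_swap_of_step hz (d + 1) i hj h
    intro i hi j hj h
    rcases lt_trichotomy i j with h' | h' | h'
    · exact absurd h (key i j h' hj)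
    · exact h'
    · exact absurd h.symm (key j i h' hi)
  · have closed : ∀ x y : FaceFlag Φ, M.glue x = some y → (∃ i ≤ n, (z i).1 = x.1) →
        ∃ i ≤ n, (z i).1 = y.1 := by
      rintro x y hxy ⟨i, hi, hx⟩
      rcases flag_cases hz hc hi hx with ⟨j, hj, rfl⟩ | ⟨j, hj, h⟩ | h
      · rcases hj.lt_or_eq with hj' | rfl
        · rw [hz j hj'] at hxy
          exact ⟨j + 1, hj', by rw [← Option.some_injective _ hxy]; rfl⟩
        · rcases hc with hc | hc
          · rw [hc.1] at hxy
            cases hxy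
          · rw [hc] at hxy
            exact ⟨0, Nat.zero_le _, by rw [← Option.some_injective _ hxy]; rfl⟩
      · have := (M.glue_symm _ _ h).symm.trans hxy
        exact ⟨j, hj, by rw [Option.some_injective _ this]⟩
      · rw [h] at hxy
        cases hxy
    have key : ∀ κ μ : Corner Φ,
        Relation.EqvGen (fun κ l : Corner Φ => ∃ i j, M.glue (κ, i) = some (l, j)) κ μ →
        ((∃ i ≤ n, (z i).1 = κ) ↔ ∃ i ≤ n, (z i).1 = μ) := by
      intro κ μ h
      induction h with
      | rel κ μ h =>
        obtain ⟨i, j, h⟩ := h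
        exact ⟨closed _ _ h, closed _ _ (M.glue_symm _ _ h)⟩
      | refl κ => exact Iff.rfl
      | symm κ μ _ ih => exact ih.symm
      | trans κ μ ν _ _ ih ih' => exact ih.trans ih'
    exact (key _ _ (Quot.eqvGen_exact hκ)).2 ⟨0, Nat.zero_le _, rfl⟩
  · rintro ⟨i, hi, rfl⟩
    exact vertex_of_step hz i hi

/-- The coordinate system of the face across the side of `x`, in which the side of `x` is the axis
`u = 0`; it is `x` itself if the side is on the boundary. -/
def next (M : QuadMesh Φ) (x : FaceFlag Φ) : FaceFlag Φ :=
  match M.glue x with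
  | none => x
  | some y => y.swap

theorem glue_next {x : FaceFlag Φ} (h : M.glue x ≠ none) : M.glue x = some (M.next x).swap := by
  rcases h' : M.glue x with _ | y
  · exact absurd h' h
  · simp [next, h', FaceFlag.swap_swap]

theorem exists_return [Finite Φ] {z : ℕ → FaceFlag Φ}
    (hz : ∀ i, M.glue (z i) = some (z (i + 1)).swap) : ∃ d, 0 < d ∧ z 0 = z d := by
  obtain ⟨i, j, hij, h⟩ := Finite.exists_ne_map_eq_of_infinite z
  wlog hlt : i < j generalizing i j
  · exact this j i hij.symm h.symm (by omega)
  obtain ⟨d, rfl⟩ := Nat.exists_eq_add_of_lt hlt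
  exact ⟨d + 1, by omega, eq_zero_of_eq (n := i + (d + 1)) (fun i _ => hz i) i (d + 1) le_rfl h⟩

/-- A boundary vertex has a fan that starts and ends with a boundary edge. -/
theorem exists_isFan_of_boundary [Finite Φ] {y : FaceFlag Φ} (hy : M.glue y = none) :
    ∃ n z, M.IsFan (M.vertex y.1) n z ∧ M.glue (z n) = none := by
  classical
  let z : ℕ → FaceFlag Φ := fun i => M.next^[i] y.swap
  have hs : ∀ i, M.glue (z i) ≠ none → M.glue (z i) = some (z (i + 1)).swap := by
    intro i h
    rw [glue_next h]
    simp only [z, Function.iterate_succ_apply']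
  have hret : ∀ d, 0 < d → (∀ i < d, M.glue (z i) = some (z (i + 1)).swap) → z 0 ≠ z d := by
    intro d hd h h0
    have := h (d - 1) (by omega)
    rw [show d - 1 + 1 = d by omega, ← h0, show (z 0).swap = y from FaceFlag.swap_swap y] at this
    have := M.glue_symm _ _ this
    rw [hy] at this
    cases this
  have hex : ∃ n, M.glue (z n) = none := by
    by_contra! h
    obtain ⟨d, hd, h0⟩ := exists_return fun i => hs i (h i)
    exact hret d hd (fun i _ => hs i (h i)) h0
  have hst : ∀ i < Nat.find hex, M.glue (z i) = some (z (i + 1)).swap :=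
    fun i hi => hs i (Nat.find_min hex hi)
  refine ⟨Nat.find hex, z, ?_, Nat.find_spec hex⟩
  exact isFan_of_step hst (fun d hd hdn => hret d hd fun i hi => hst i (by omega))
    (Or.inl ⟨Nat.find_spec hex, by rw [show (z 0).swap = y from FaceFlag.swap_swap y]; exact hy⟩)

/-- An interior vertex has a closed fan, which can be cut open at any given edge. -/
theorem exists_isFan_of_interior [Finite Φ] {x : FaceFlag Φ}
    (hx : ∀ y : FaceFlag Φ, M.vertex y.1 = M.vertex x.1 → M.glue y ≠ none) :
    ∃ n z, M.IsFan (M.vertex x.1) n z ∧ z n = x ∧ M.RunsAround (M.vertex x.1) z := by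
  classical
  let z : ℕ → FaceFlag Φ := fun i => M.next^[i] (M.next x)
  have hz0 : M.glue x = some (z 0).swap := glue_next (hx x rfl)
  have hv0 : M.vertex (z 0).1 = M.vertex x.1 := (vertex_eq_of_glue hz0).symm
  have hstep : ∀ i, M.vertex (z i).1 = M.vertex x.1 → M.glue (z i) = some (z (i + 1)).swap := by
    intro i hi
    rw [glue_next (hx _ hi)]
    simp only [z, Function.iterate_succ_apply']
  have hv : ∀ i, M.vertex (z i).1 = M.vertex x.1 := by
    intro i
    induction i with
    | zero => exact hv0
    | succ i ih => exact (vertex_eq_of_glue (hstep i ih)).symm.trans ih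
  have hz : ∀ i, M.glue (z i) = some (z (i + 1)).swap := fun i => hstep i (hv i)
  have hex : ∃ n, z 0 = z (n + 1) := by
    obtain ⟨d, hd, h⟩ := exists_return hz
    exact ⟨d - 1, by rwa [show d - 1 + 1 = d by omega]⟩
  have hn := hz (Nat.find hex)
  rw [← Nat.find_spec hex] at hn
  refine ⟨Nat.find hex, z, ?_, glue_unique hn hz0, hv0, hz⟩
  rw [← hv0]
  refine isFan_of_step (fun i _ => hz i) (fun d hd hdn h => ?_) (Or.inr hn)
  exact Nat.find_min hex (show d - 1 < _ by omega) (by rwa [show d - 1 + 1 = d by omega])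

namespace IsFan

variable {γ : M.Vertex} {n : ℕ} {z : ℕ → FaceFlag Φ}

theorem vertex_eq (hf : M.IsFan γ n z) {i : ℕ} (hi : i ≤ n) : M.vertex (z i).1 = γ :=
  (hf.mem_iff _).2 ⟨i, hi, rfl⟩

/-- The corners at a vertex, numbered by a fan. -/
def equiv (hf : M.IsFan γ n z) : Fin (n + 1) ≃ M.CornersAt γ :=
  Equiv.ofBijective
    (fun i => M.cornerAt (z i).1 (hf.vertex_eq (Nat.lt_succ_iff.1 i.2)))
    ⟨fun i j h => Fin.ext (hf.inj i (Nat.lt_succ_iff.1 i.2) j (Nat.lt_succ_iff.1 j.2)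
      (congrArg Subtype.val h)), fun κ => by
        obtain ⟨i, hi, h⟩ := (hf.mem_iff κ.1).1 κ.2
        exact ⟨⟨i, Nat.lt_succ_iff.2 hi⟩, Subtype.ext h⟩⟩

theorem valence_eq (hf : M.IsFan γ n z) : M.valence γ = n + 1 := by
  rw [valence, ← Nat.card_congr hf.equiv, Nat.card_fin]

theorem flag_cases (hf : M.IsFan γ n z) {x : FaceFlag Φ} (hx : M.vertex x.1 = γ) :
    (∃ i ≤ n, x = z i) ∨ (∃ i ≤ n, M.glue (z i) = some x) ∨ M.glue x = none := by
  obtain ⟨i, hi, h⟩ := (hf.mem_iff _).1 hx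
  exact QuadMesh.flag_cases hf.step hf.close hi h

/-- A symmetric relation holds across all the shared edges at a vertex as soon as it holds between
consecutive faces of a fan. -/
theorem forall_glue (hf : M.IsFan γ n z) (Q : FaceFlag Φ → FaceFlag Φ → Prop)
    (hQ : ∀ x y, M.glue x = some y → Q x y → Q y x)
    (h : ∀ i < n, Q (z i) (z (i + 1)).swap)
    (hc : M.glue (z n) = some (z 0).swap → Q (z n) (z 0).swap)
    {x y : FaceFlag Φ} (hx : M.vertex x.1 = γ) (hxy : M.glue x = some y) : Q x y := by
  have key : ∀ i ≤ n, ∀ y, M.glue (z i) = some y → Q (z i) y := by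
    intro i hi y hy
    rcases hi.lt_or_eq with hi | rfl
    · rw [hf.step i hi] at hy
      exact Option.some_injective _ hy ▸ h i hi
    · rcases hf.close with h' | h'
      · rw [h'.1] at hy
        cases hy
      · have e := Option.some_injective _ (h'.symm.trans hy)
        exact e ▸ hc h'
  rcases hf.flag_cases hx with ⟨i, hi, rfl⟩ | ⟨i, hi, h'⟩ | h'
  · exact key i hi y hxy
  · have e := Option.some_injective _ ((M.glue_symm _ _ h').symm.trans hxy)
    exact e ▸ hQ _ _ h' (key i hi x h')
  · rw [h'] at hxy
    cases hxy

end IsFan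

theorem edgeEnd_eq_iff {x y : FaceFlag Φ} :
    (Quot.mk _ x : M.EdgeEnd) = Quot.mk _ y ↔ x = y ∨ M.glue x = some y := by
  constructor
  · intro h
    replace h := Quot.eqvGen_exact h
    induction h with
    | rel x y h => exact Or.inr h
    | refl x => exact Or.inl rfl
    | symm x y _ ih =>
      rcases ih with rfl | h
      · exact Or.inl rfl
      · exact Or.inr (M.glue_symm _ _ h)
    | trans x y w _ _ ih ih' =>
      rcases ih with rfl | h
      · exact ih'
      · rcases ih' with rfl | h'
        · exact Or.inr h
        · exact Or.inl (glue_unique h (M.glue_symm _ _ h'))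
  · rintro (rfl | h)
    · rfl
    · exact Quot.sound h

end QuadMesh

namespace GluingData

variable {M : QuadMesh Φ} {s l : ℕ} (D : GluingData M s l)

theorem isCrossing_of_glue {x y : FaceFlag Φ} (h : M.glue x = some y) (hx : D.IsCrossing x) :
    D.IsCrossing y := by
  refine ⟨by simp [M.glue_symm x y h], ?_⟩
  rw [D.fa_glue h (by simp), hx.2]
  simp

open Classical in
theorem crossEdge_mk (x : FaceFlag Φ) :
    D.crossEdge (Quot.mk _ x) = if D.IsCrossing x then 1 else 0 := by
  refine if_congr ⟨?_, fun h => ⟨x, rfl, h⟩⟩ rfl rfl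
  rintro ⟨y, e, hy⟩
  rcases QuadMesh.edgeEnd_eq_iff.1 e with rfl | h
  · exact hy
  · exact D.isCrossing_of_glue h hy

open Classical in
/-- The number of crossing edges at a vertex, counted along a fan. -/
theorem sum_crossEdge [Finite Φ] {γ : M.Vertex} {n : ℕ} {z : ℕ → FaceFlag Φ}
    (hf : M.IsFan γ n z) :
    ∑ τ : M.EdgesAt γ, D.crossEdge τ.1 =
      ∑ i ∈ Finset.range (n + 1), if D.IsCrossing (z i) then 1 else 0 := by
  symm
  have hv : ∀ i : ℕ, i ∈ Finset.range (n + 1) → i ≤ n := fun i hi => by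
    simpa [Nat.lt_succ_iff] using hi
  have hpt : ∀ i : ℕ, ∀ hi : i ≤ n, QuadMesh.EdgeEnd.point (Quot.mk _ (z i) : M.EdgeEnd) = γ :=
    fun i hi => hf.vertex_eq hi
  -- The fan is indexed by `ℕ`; the index is replaced by `0` beyond `n`.
  let e : ℕ → M.EdgesAt γ := fun i =>
    if hi : i ≤ n then Subtype.mk (Quot.mk _ (z i)) (hpt i hi)
    else Subtype.mk (Quot.mk _ (z 0)) (hpt 0 (Nat.zero_le n))
  have he : ∀ i, i ≤ n → (e i).1 = Quot.mk _ (z i) := fun i hi =>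
    congrArg Subtype.val (dif_pos hi)
  refine Finset.sum_of_injOn e ?_ (fun _ _ => Finset.mem_coe.2 (Finset.mem_univ _)) ?_ ?_
  · intro i hi j hj hij
    have hi' := hv i hi
    have hj' := hv j hj
    have h := congrArg Subtype.val hij
    rw [he i hi', he j hj'] at h
    rcases QuadMesh.edgeEnd_eq_iff.1 h with h | h
    · exact hf.inj i hi' j hj' (congrArg Prod.fst h)
    · exfalso
      -- The side of `z i` is glued to the other side of the next face of the fan.
      rcases hi'.lt_or_eq with hlt | rfl
      · have h2 := Option.some_injective _ ((hf.step i hlt).symm.trans h)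
        have := hf.inj (i + 1) hlt j hj' (congrArg Prod.fst h2 :)
        rw [← this] at h2
        exact FaceFlag.swap_ne _ h2
      · rcases hf.close with h' | h'
        · rw [h'.1] at h
          cases h
        · have h2 := Option.some_injective _ (h'.symm.trans h)
          have := hf.inj 0 (Nat.zero_le _) j hj' (congrArg Prod.fst h2 :)
          rw [← this] at h2
          exact FaceFlag.swap_ne _ h2
  · rintro ⟨τ, hτ⟩ - hne
    obtain ⟨x, rfl⟩ := Quot.exists_rep τ
    change D.crossEdge (Quot.mk _ x) = 0
    rw [crossEdge_mk, if_neg]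
    intro hx
    rcases hf.flag_cases hτ with ⟨i, hi, h⟩ | ⟨i, hi, h⟩ | h
    · exact hne ⟨i, by simpa using Nat.lt_succ_of_le hi, Subtype.ext ((he i hi).trans (congrArg _ h.symm))⟩
    · exact hne ⟨i, by simpa using Nat.lt_succ_of_le hi,
        Subtype.ext ((he i hi).trans (Quot.sound h))⟩
    · have := hx.1
      simp [h] at this
  · intro i hi
    rw [he i (hv i hi), crossEdge_mk]

end GluingData

/-! ### Chains of linear relations -/

/-- The sequences `h 0, …, h n` in which any two consecutive terms satisfy a linear relation. -/
def chain {E : Type*} [AddCommGroup E] [Module ℝ E] (R : ℕ → Submodule ℝ (E × E)) (n : ℕ) :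
    Submodule ℝ (Fin (n + 1) → E) where
  carrier := {h | ∀ i : Fin n, (h i.castSucc, h i.succ) ∈ R i}
  zero_mem' := fun i => (R i).zero_mem
  add_mem' := fun hf hg i => (R i).add_mem (hf i) (hg i)
  smul_mem' := fun c _ hf i => (R i).smul_mem c (hf i)

/-- If every element has a successor for each of the relations, the first term of a chain is
arbitrary, and each further term is determined up to the successors of `0`. -/
theorem finrank_chain {E : Type*} [AddCommGroup E] [Module ℝ E] [FiniteDimensional ℝ E]
    (R : ℕ → Submodule ℝ (E × E)) (n : ℕ) (hR : ∀ i < n, ∀ e, ∃ e', (e, e') ∈ R i) :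
    Module.finrank ℝ (chain R n) = Module.finrank ℝ E +
      ∑ i ∈ Finset.range n, Module.finrank ℝ ((R i).comap (LinearMap.inr ℝ E E)) := by
  induction n with
  | zero =>
    have : chain R 0 = ⊤ := by
      rw [eq_top_iff]
      exact fun h _ i => i.elim0
    rw [this, finrank_top, Module.finrank_pi_fintype]
    simp
  | succ n ih =>
    let φ : chain R (n + 1) →ₗ[ℝ] chain R n :=
      { toFun := fun h => ⟨fun i => h.1 i.castSucc, fun i => h.2 i.castSucc⟩
        map_add' := fun _ _ => rfl
        map_smul' := fun _ _ => rfl }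
    have hφ : LinearMap.range φ = ⊤ := by
      rw [LinearMap.range_eq_top]
      rintro ⟨h, hh⟩
      obtain ⟨e, he⟩ := hR n (by omega) (h (Fin.last n))
      refine ⟨⟨Fin.snoc (α := fun _ => E) h e, fun i => ?_⟩, ?_⟩
      · refine Fin.lastCases ?_ (fun i => ?_) i
        · rw [Fin.succ_last, Fin.snoc_last, Fin.snoc_castSucc]
          exact he
        · rw [Fin.succ_castSucc, Fin.snoc_castSucc, Fin.snoc_castSucc]
          exact hh i
      · refine Subtype.ext (funext fun i => ?_)
        exact Fin.snoc_castSucc (α := fun _ => E) e h i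
    let ψ : LinearMap.ker φ →ₗ[ℝ] (R n).comap (LinearMap.inr ℝ E E) :=
      { toFun := fun h => ⟨h.1.1 (Fin.last (n + 1)), by
          have h1 := h.1.2 (Fin.last n)
          have h2 := congrFun (congrArg Subtype.val (LinearMap.mem_ker.1 h.2)) (Fin.last n)
          rw [show h.1.1 (Fin.last n).castSucc = 0 from h2] at h1
          exact h1⟩
        map_add' := fun _ _ => rfl
        map_smul' := fun _ _ => rfl }
    have hψ : Function.Bijective ψ := by
      constructor
      · intro f g hfg
        refine Subtype.ext (Subtype.ext (funext fun i => ?_))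
        refine Fin.lastCases ?_ (fun i => ?_) i
        · exact congrArg Subtype.val hfg
        · exact (congrFun (congrArg Subtype.val (LinearMap.mem_ker.1 f.2)) i).trans
            (congrFun (congrArg Subtype.val (LinearMap.mem_ker.1 g.2)) i).symm
      · rintro ⟨e, he⟩
        refine ⟨⟨⟨Fin.snoc (α := fun _ => E) (fun _ => 0) e, fun i => ?_⟩, ?_⟩, ?_⟩
        · refine Fin.lastCases ?_ (fun i => ?_) i
          · rw [Fin.succ_last, Fin.snoc_last, Fin.snoc_castSucc]
            exact he
          · rw [Fin.succ_castSucc, Fin.snoc_castSucc, Fin.snoc_castSucc]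
            exact (R _).zero_mem
        · refine LinearMap.mem_ker.2 (Subtype.ext (funext fun i => ?_))
          exact Fin.snoc_castSucc (α := fun _ => E) e (fun _ => 0) i
        · refine Subtype.ext ?_
          exact Fin.snoc_last (α := fun _ => E) e (fun _ => 0)
    have := φ.finrank_range_add_finrank_ker
    rw [hφ, finrank_top, ih (fun i hi => hR i (by omega)),
      (LinearEquiv.ofBijective ψ hψ).finrank_eq] at this
    rw [← this, Finset.sum_range_succ, add_assoc]

/-! ### The dimension of the space of Taylor data at a vertex -/

/-- `orientTaylor` as a linear equivalence. -/
def orientTaylorEquiv (i : Bool) : (Fin 4 → ℝ) ≃ₗ[ℝ] (Fin 4 → ℝ) where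
  toFun := orientTaylor i
  map_add' := orientTaylor_add i
  map_smul' := orientTaylor_smul i
  invFun := orientTaylor i
  left_inv := orientTaylor_orientTaylor i
  right_inv := orientTaylor_orientTaylor i

theorem orientTaylor_not (i : Bool) (h : Fin 4 → ℝ) :
    orientTaylor (!i) h = orientTaylor true (orientTaylor i h) := by
  cases i
  · rfl
  · exact (orientTaylor_orientTaylor true h).symm

namespace GluingData

variable {M : QuadMesh Φ} {s l : ℕ} (D : GluingData M s l)

/-- The relation between the Taylor data in the coordinates `x` and those on the face across the
side of `x`, in the coordinates `M.next x`. -/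
def nextTaylorSpace (x : FaceFlag Φ) : Submodule ℝ ((Fin 4 → ℝ) × (Fin 4 → ℝ)) :=
  (D.edgeTaylorSpace x).comap
    (LinearMap.prodMap LinearMap.id (orientTaylorEquiv true).toLinearMap)

theorem mem_nextTaylorSpace {x : FaceFlag Φ} {g h : Fin 4 → ℝ} :
    (g, h) ∈ D.nextTaylorSpace x ↔ g 0 = h 0 ∧ g 1 = h 2 ∧
      g 2 = D.fa x 0 * h 2 + D.fb x 0 * h 1 ∧
      ∃ ρ : ℝ, g 3 = 2 * D.fa x 0 * ρ + D.fb x 0 * h 3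
        + deriv (D.fa x) 0 * h 2 + deriv (D.fb x) 0 * h 1 :=
  Iff.rfl

theorem exists_mem_nextTaylorSpace {x y : FaceFlag Φ} (h : M.glue x = some y) (g : Fin 4 → ℝ) :
    ∃ g', (g, g') ∈ D.nextTaylorSpace x := by
  have hb := D.fb_ne_zero h (u := 0) (by simp)
  refine ⟨![g 0, (g 2 - D.fa x 0 * g 1) / D.fb x 0, g 1,
    (g 3 - deriv (D.fa x) 0 * g 1
      - deriv (D.fb x) 0 * ((g 2 - D.fa x 0 * g 1) / D.fb x 0)) / D.fb x 0],
    (D.mem_nextTaylorSpace).2 ⟨rfl, rfl, ?_, 0, ?_⟩⟩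
  · simp
    field_simp
    ring
  · simp
    field_simp
    ring

open Classical in
/-- The mixed derivative on the next face is free unless the edge is a crossing edge. -/
theorem finrank_comap_inr_nextTaylorSpace {x y : FaceFlag Φ} (h : M.glue x = some y) :
    Module.finrank ℝ ((D.nextTaylorSpace x).comap (LinearMap.inr ℝ (Fin 4 → ℝ) (Fin 4 → ℝ))) =
      if D.IsCrossing x then 0 else 1 := by
  have hb := D.fb_ne_zero h (u := 0) (by simp)
  have hmem : ∀ g : Fin 4 → ℝ,
      g ∈ (D.nextTaylorSpace x).comap (LinearMap.inr ℝ (Fin 4 → ℝ) (Fin 4 → ℝ)) ↔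
      g 0 = 0 ∧ g 1 = 0 ∧ g 2 = 0 ∧ (D.fa x 0 = 0 → g 3 = 0) := by
    intro g
    rw [Submodule.mem_comap, LinearMap.inr_apply, mem_nextTaylorSpace]
    constructor
    · rintro ⟨h0, h1, h2, ρ, h3⟩
      simp only [Pi.zero_apply] at h0 h1 h2 h3
      rw [← h1] at h2 h3
      have h1' : g 1 = 0 := by simpa [hb] using h2
      refine ⟨h0.symm, h1', h1.symm, fun ha => ?_⟩
      simpa [ha, h1', hb] using h3
    · rintro ⟨h0, h1, h2, h3⟩
      refine ⟨h0.symm, h2.symm, by simp [h1, h2], ?_⟩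
      by_cases ha : D.fa x 0 = 0
      · exact ⟨0, by simp [h1, h2, h3 ha]⟩
      · refine ⟨-(D.fb x 0 * g 3) / (2 * D.fa x 0), ?_⟩
        simp only [h1, h2, Pi.zero_apply]
        field_simp
        ring
  split_ifs with hx
  · have : (D.nextTaylorSpace x).comap (LinearMap.inr ℝ (Fin 4 → ℝ) (Fin 4 → ℝ)) = ⊥ := by
      rw [eq_bot_iff]
      intro g hg
      obtain ⟨h0, h1, h2, h3⟩ := (hmem g).1 hg
      refine (Submodule.mem_bot ℝ).2 (funext fun i => ?_)
      fin_cases i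
      · exact h0
      · exact h1
      · exact h2
      · exact h3 hx.2
    rw [this, finrank_bot]
  · have ha : D.fa x 0 ≠ 0 := fun ha => hx ⟨by simp [h], ha⟩
    refine finrank_eq_one_iff'.2 ⟨⟨![0, 0, 0, 1], (hmem _).2 ⟨rfl, rfl, rfl, fun h => absurd h ha⟩⟩,
      fun h0 => ?_, fun g => ⟨g.1 3, Subtype.ext (funext fun i => ?_)⟩⟩
    · have := congrFun (congrArg Subtype.val h0) 3
      simp at this
    · obtain ⟨h0, h1, h2, -⟩ := (hmem g.1).1 g.2
      fin_cases i
      · simp [h0]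
      · simp [h1]
      · simp [h2]
      · simp

open Classical in
/-- If the relation that closes the fan follows from the others, Taylor data at the vertex are
chains of Taylor data along the fan. -/
theorem finrank_taylorSpace_of_close {γ : M.Vertex} {n : ℕ} {z : ℕ → FaceFlag Φ}
    (hf : M.IsFan γ n z)
    (hclose : M.glue (z n) = some (z 0).swap → ∀ g : Fin (n + 1) → Fin 4 → ℝ,
      g ∈ chain (fun i => D.nextTaylorSpace (z i)) n →
        (g (Fin.last n), g 0) ∈ D.nextTaylorSpace (z n)) :
    Module.finrank ℝ (D.taylorSpace γ) =
      4 + ∑ i ∈ Finset.range n, if D.IsCrossing (z i) then 0 else 1 := by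
  let Ψ : (M.CornersAt γ → Fin 4 → ℝ) ≃ₗ[ℝ] (Fin (n + 1) → Fin 4 → ℝ) :=
    (LinearEquiv.funCongrLeft ℝ (Fin 4 → ℝ) hf.equiv).trans
      (LinearEquiv.piCongrRight fun i => orientTaylorEquiv (z i).2)
  have hΨ : ∀ h i, Ψ h i = orientTaylor (z i).2 (h (hf.equiv i)) := fun _ _ => rfl
  have hmap : (D.taylorSpace γ).map Ψ.toLinearMap = chain (fun i => D.nextTaylorSpace (z i)) n := by
    apply le_antisymm
    · rintro _ ⟨h, hh, rfl⟩ i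
      change (Ψ h _, orientTaylor true (Ψ h _)) ∈ D.edgeTaylorSpace (z i)
      rw [hΨ, hΨ, ← orientTaylor_not]
      exact hh (hf.equiv i.castSucc) (hf.equiv i.succ) _ _ (hf.step i i.2)
    · intro g hg
      refine ⟨Ψ.symm g, ?_, Ψ.apply_symm_apply g⟩
      obtain ⟨h, rfl⟩ := Ψ.surjective g
      rw [Ψ.symm_apply_apply]
      have key : ∀ x y : FaceFlag Φ, M.vertex x.1 = γ → M.glue x = some y →
          ∀ (hx : M.vertex x.1 = γ) (hy : M.vertex y.1 = γ),
          (orientTaylor x.2 (h (M.cornerAt x.1 hx)), orientTaylor y.2 (h (M.cornerAt y.1 hy))) ∈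
            D.edgeTaylorSpace x := by
        intro x y hx hxy
        refine hf.forall_glue (fun x y => M.glue x = some y →
          ∀ (hx : M.vertex x.1 = γ) (hy : M.vertex y.1 = γ),
          (orientTaylor x.2 (h (M.cornerAt x.1 hx)), orientTaylor y.2 (h (M.cornerAt y.1 hy))) ∈
            D.edgeTaylorSpace x) ?_ ?_ ?_ hx hxy hxy
        · exact fun x y hxy hQ _ hy hx => D.edgeTaylorSpace_glue hxy (hQ hxy hx hy)
        · intro i hi _ hx hy
          have := hg ⟨i, hi⟩
          change (Ψ h _, orientTaylor true (Ψ h _)) ∈ D.edgeTaylorSpace (z i) at this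
          rw [hΨ, hΨ, ← orientTaylor_not] at this
          exact this
        · intro hc _ hx hy
          have := hclose hc _ hg
          change (Ψ h _, orientTaylor true (Ψ h _)) ∈ D.edgeTaylorSpace (z n) at this
          rw [hΨ, hΨ, ← orientTaylor_not] at this
          exact this
      intro κ μ i j hκμ
      exact key _ _ κ.2 hκμ κ.2 μ.2
  rw [← LinearEquiv.finrank_map_eq Ψ (D.taylorSpace γ)]
  change Module.finrank ℝ ((D.taylorSpace γ).map Ψ.toLinearMap) = _
  rw [hmap, finrank_chain _ _ fun i hi e => D.exists_mem_nextTaylorSpace (hf.step i hi) e,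
    Module.finrank_fin_fun]
  congr 1
  exact Finset.sum_congr rfl fun i hi =>
    D.finrank_comap_inr_nextTaylorSpace (hf.step i (Finset.mem_range.1 hi))

/-- Along a chain the first derivatives are transported by the matrices of the compatibility
condition. -/
theorem prod_mulVec_of_chain {n : ℕ} {z : ℕ → FaceFlag Φ} {g : Fin (n + 1) → Fin 4 → ℝ}
    (hg : g ∈ chain (fun i => D.nextTaylorSpace (z i)) n) :
    g 0 0 = g (Fin.last n) 0 ∧ ![g 0 1, g 0 2] =
      Matrix.mulVec (((List.range n).map
        (fun i => (!![0, 1; D.fb (z i) 0, D.fa (z i) 0] : Matrix (Fin 2) (Fin 2) ℝ))).prod)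
          ![g (Fin.last n) 1, g (Fin.last n) 2] := by
  induction n with
  | zero => simp
  | succ n ih =>
    obtain ⟨i0, i1⟩ := ih (g := fun i => g i.castSucc) fun i => hg i.castSucc
    obtain ⟨h0, h1, h2, -⟩ := (D.mem_nextTaylorSpace).1 (hg (Fin.last n))
    simp only [Fin.castSucc_zero, Fin.succ_last, Fin.val_last] at i0 i1 h0 h1 h2
    refine ⟨i0.trans h0, ?_⟩
    rw [i1, List.range_succ, List.map_append, List.prod_append, List.map_singleton,
      List.prod_singleton, ← Matrix.mulVec_mulVec]
    congr 1
    rw [h1, h2]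
    funext j
    fin_cases j
    · simp [Matrix.mulVec, dotProduct]
    · simp [Matrix.mulVec, dotProduct]
      ring

/-- By the first compatibility condition the values and first derivatives of a chain close up. -/
theorem first_order_close {γ : M.Vertex} (hcomp : D.CompatibleAt γ) {n : ℕ}
    {z : ℕ → FaceFlag Φ} (hf : M.IsFan γ n z) (hr : M.RunsAround γ z)
    {g : Fin (n + 1) → Fin 4 → ℝ} (hg : g ∈ chain (fun i => D.nextTaylorSpace (z i)) n) :
    g (Fin.last n) 0 = g 0 0 ∧ g (Fin.last n) 1 = g 0 2 ∧
      g (Fin.last n) 2 = D.fa (z n) 0 * g 0 2 + D.fb (z n) 0 * g 0 1 := by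
  obtain ⟨h0, h1⟩ := D.prod_mulVec_of_chain hg
  have hP := hcomp z hr
  rw [hf.valence_eq, List.range_succ, List.map_append, List.prod_append, List.map_singleton,
    List.prod_singleton, mul_eq_one_comm] at hP
  have h2 := congrArg (Matrix.mulVec
    (!![0, 1; D.fb (z n) 0, D.fa (z n) 0] : Matrix (Fin 2) (Fin 2) ℝ)) h1
  rw [Matrix.mulVec_mulVec, hP, Matrix.one_mulVec] at h2
  have e0 := congrFun h2 0
  have e1 := congrFun h2 1
  simp [Matrix.mulVec, dotProduct] at e0 e1
  refine ⟨h0.symm, e0.symm, ?_⟩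
  rw [← e1]
  ring

/-- At a crossing vertex the mixed derivatives close up by the second compatibility condition. -/
theorem mixed_close {b0 b1 b2 b3 a0' a1' a2' a3' b0' b1' b2' b3' q0 q1 q2 q3 s0 s1 s2 s3 : ℝ}
    (h02 : b0 * b2 = 1) (h13 : b1 * b3 = 1)
    (H1 : a1' + b0' / b0 = -b1 * (a3' + b2' / b2))
    (H2 : a2' + b1' / b1 = -b2 * (a0' + b3' / b3))
    (k0 : q3 = b0 * q1) (k1 : q0 = b1 * q2)
    (m0 : s0 = b0 * s1 + a0' * q0 + b0' * q1) (m1 : s1 = b1 * s2 + a1' * q1 + b1' * q2)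
    (m2 : s2 = b2 * s3 + a2' * q2 + b2' * q3) :
    s3 = b3 * s0 + a3' * q3 + b3' * q0 := by
  have hb0 : b0 ≠ 0 := left_ne_zero_of_mul_eq_one h02
  have hb1 : b1 ≠ 0 := left_ne_zero_of_mul_eq_one h13
  obtain rfl : b2 = 1 / b0 := by field_simp; linarith
  obtain rfl : b3 = 1 / b1 := by field_simp; linarith
  subst m0 m1 m2 k0 k1
  field_simp at H1 H2 ⊢
  linear_combination (-q1) * H1 + (-q2) * H2

open Classical in
/-- The dimension of the space of Taylor data at one vertex. -/
theorem finrank_taylorSpace [Finite Φ] (γ : M.Vertex) (hcomp : D.CompatibleAt γ)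
    (hcross : D.CrossCompatibleAt γ) :
    Module.finrank ℝ (D.taylorSpace γ) + ∑ τ : M.EdgesAt γ, D.crossEdge τ.1 =
      M.valence γ + 3 + D.crossVertex γ := by
  -- It suffices to cut the fan at an edge that is a crossing edge only at a crossing vertex.
  have main : ∀ (n : ℕ) (z : ℕ → FaceFlag Φ), M.IsFan γ n z →
      (D.IsCrossing (z n) ↔ D.IsCrossingVertex γ) →
      (M.glue (z n) = some (z 0).swap → ∀ g : Fin (n + 1) → Fin 4 → ℝ,
        g ∈ chain (fun i => D.nextTaylorSpace (z i)) n →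
          (g (Fin.last n), g 0) ∈ D.nextTaylorSpace (z n)) →
      Module.finrank ℝ (D.taylorSpace γ) + ∑ τ : M.EdgesAt γ, D.crossEdge τ.1 =
        M.valence γ + 3 + D.crossVertex γ := by
    intro n z hf hn hclose
    rw [D.finrank_taylorSpace_of_close hf hclose, D.sum_crossEdge hf, hf.valence_eq,
      Finset.sum_range_succ, crossVertex, if_congr hn rfl rfl]
    have : (∑ i ∈ Finset.range n, if D.IsCrossing (z i) then 0 else 1) +
        (∑ i ∈ Finset.range n, if D.IsCrossing (z i) then 1 else 0) = n := by
      rw [← Finset.sum_add_distrib]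
      trans ∑ i ∈ Finset.range n, 1
      · refine Finset.sum_congr rfl fun i _ => ?_
        split_ifs <;> rfl
      · simp
    omega
  by_cases hint : ∃ y : FaceFlag Φ, M.vertex y.1 = γ ∧ M.glue y = none
  · obtain ⟨y, rfl, hy⟩ := hint
    obtain ⟨n, z, hf, hn⟩ := QuadMesh.exists_isFan_of_boundary hy
    refine main n z hf ⟨fun h => ?_, fun h => ?_⟩ fun h => ?_
    · have := h.1
      simp [hn] at this
    · have := (h y rfl).1
      simp [hy] at this
    · rw [hn] at h
      cases h
  · push Not at hint
    by_cases hcv : D.IsCrossingVertex γ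
    · obtain ⟨κ, rfl⟩ := Quot.exists_rep γ
      obtain ⟨n, z, hf, hn, hr⟩ :=
        QuadMesh.exists_isFan_of_interior (M := M) (x := (κ, false)) hint
      refine main n z hf ⟨fun _ => hcv, fun _ => hcv _ (hf.vertex_eq le_rfl)⟩ fun hc g hg => ?_
      obtain ⟨hval, hz⟩ := hcross hcv
      have hn3 : n = 3 := by
        have := hf.valence_eq
        change M.valence (M.vertex κ) = 4 at hval
        change M.valence (M.vertex κ) = n + 1 at this
        omega
      subst hn3
      obtain ⟨e0, e1, e2⟩ := D.first_order_close hcomp hf hr hg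
      have ha : ∀ i, i ≤ 3 → D.fa (z i) 0 = 0 := fun i hi => (hcv _ (hf.vertex_eq hi)).2
      have h4 : z 4 = z 0 := by
        have := Option.some_injective _ ((hr.2 3).symm.trans hc)
        rw [← FaceFlag.swap_swap (z 4), this, FaceFlag.swap_swap]
      obtain ⟨H1, H2⟩ := hz z hr
      rw [h4] at H1 H2
      have hP := hcomp z hr
      rw [show M.valence (Quot.mk _ κ) = 4 from hval] at hP
      simp only [List.range_succ, List.range_zero, List.map_append, List.map_cons, List.map_nil,
        List.prod_append, List.prod_cons, List.prod_nil, List.nil_append, mul_one, ha 0 (by omega),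
        ha 1 (by omega), ha 2 (by omega), ha 3 le_rfl] at hP
      have p00 := congrFun (congrFun hP 0) 0
      have p11 := congrFun (congrFun hP 1) 1
      simp [Matrix.mul_apply, Fin.sum_univ_two] at p00 p11
      -- With crossing edges, the relations between consecutive faces involve no free parameter.
      have hrel : ∀ i : Fin 3, g i.castSucc 1 = g i.succ 2 ∧
          g i.castSucc 2 = D.fb (z i) 0 * g i.succ 1 ∧
          g i.castSucc 3 = D.fb (z i) 0 * g i.succ 3 + deriv (D.fa (z i)) 0 * g i.castSucc 1
            + deriv (D.fb (z i)) 0 * g i.succ 1 := by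
        intro i
        obtain ⟨-, k1, k2, ρ, k3⟩ := (D.mem_nextTaylorSpace).1 (hg i)
        have hi := ha i (by omega)
        rw [hi] at k2 k3
        exact ⟨k1, by rw [k2]; ring, by rw [k3, k1]; ring⟩
      obtain ⟨k1, k2, k3⟩ : g 0 1 = g 1 2 ∧ g 0 2 = D.fb (z 0) 0 * g 1 1 ∧ g 0 3 = _ := hrel 0
      obtain ⟨-, l2, l3⟩ : g 1 1 = g 2 2 ∧ g 1 2 = D.fb (z 1) 0 * g 2 1 ∧ g 1 3 = _ := hrel 1
      obtain ⟨-, -, m3⟩ : g 2 1 = g 3 2 ∧ g 2 2 = D.fb (z 2) 0 * g 3 1 ∧ g 2 3 = _ := hrel 2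
      have e1' : g 3 1 = g 0 2 := e1
      have key := mixed_close p11 p00 H1 H2 (e1'.trans k2) (k1.trans l2) k3 l3 m3
      refine (D.mem_nextTaylorSpace).2 ⟨e0, e1, e2, 0, ?_⟩
      rw [mul_zero, zero_add, ← e1]
      exact key
    · -- The mixed derivative on the last face is unconstrained across a non-crossing edge.
      obtain ⟨x, hx, hxc⟩ : ∃ x : FaceFlag Φ, M.vertex x.1 = γ ∧ ¬ D.IsCrossing x := by
        by_contra! h
        exact hcv h
      subst hx
      obtain ⟨n, z, hf, hn, hr⟩ := QuadMesh.exists_isFan_of_interior (M := M) (x := x) hint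
      subst hn
      refine main n z hf ⟨fun h => absurd h hxc, fun h => absurd h hcv⟩ fun hc g hg => ?_
      obtain ⟨e0, e1, e2⟩ := D.first_order_close hcomp hf hr hg
      have ha : D.fa (z n) 0 ≠ 0 := fun ha => hxc ⟨by simp [hc], ha⟩
      refine (D.mem_nextTaylorSpace).2 ⟨e0, e1, e2, (g (Fin.last n) 3 - D.fb (z n) 0 * g 0 3
        - deriv (D.fa (z n)) 0 * g 0 2 - deriv (D.fb (z n)) 0 * g 0 1) / (2 * D.fa (z n) 0), ?_⟩
      field_simp
      ring

theorem finrank_pi_taylorSpace [Finite Φ] :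
    Module.finrank ℝ (Submodule.pi Set.univ (fun γ : M.Vertex => D.taylorSpace γ)) =
      ∑ γ : M.Vertex, Module.finrank ℝ (D.taylorSpace γ) := by
  have : ∀ γ : M.Vertex, Finite (M.CornersAt γ) := fun γ =>
    inferInstanceAs (Finite {κ : Corner Φ // M.vertex κ = γ})
  rw [← Module.finrank_pi_fintype ℝ]
  exact LinearEquiv.finrank_eq
    { toFun := fun h γ => ⟨h.1 γ, (Submodule.mem_pi).1 h.2 γ trivial⟩
      map_add' := fun _ _ => rfl
      map_smul' := fun _ _ => rfl
      invFun := fun h => ⟨fun γ => (h γ).1, (Submodule.mem_pi).2 fun γ _ => (h γ).2⟩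
      left_inv := fun _ => rfl
      right_inv := fun _ => rfl }

end GluingData

end QuadSpline

end

open QuadSpline in
theorem proposition5p3 {Φ : Type*} [Finite Φ] (M : QuadMesh Φ) (s l : ℕ) (D : GluingData M s l)
    (hcomp : ∀ γ, D.CompatibleAt γ) (hcross : ∀ γ, D.CrossCompatibleAt γ) (r k : ℕ) :
    (∀ γ : M.Vertex, (∀ x : FaceFlag Φ, M.vertex x.1 = γ → D.separability r x ≤ k) →
      LinearMap.range (D.vertexTaylorMap r k γ) = D.taylorSpace γ) ∧
    ((∀ x : FaceFlag Φ, D.separability r x ≤ k) →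
      LinearMap.range (D.taylorMap r k) = Submodule.pi Set.univ (fun γ => D.taylorSpace γ) ∧
      (Module.finrank ℝ (LinearMap.range (D.taylorMap r k)) : ℤ) =
        ∑ γ : M.Vertex, ((M.valence γ : ℤ) + 3)
          - ∑ γ : M.Vertex, ∑ τ : M.EdgesAt γ, (D.crossEdge τ.1 : ℤ)
          + ∑ γ : M.Vertex, (D.crossVertex γ : ℤ)) := by
  refine ⟨fun γ h => D.range_vertexTaylorMap fun x hx =>
    D.isSeparated_of_separability_le (h x hx), fun h => ?_⟩
  have hrange := D.range_taylorMap (r := r) (k := k)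
    fun x => D.isSeparated_of_separability_le (h x)
  refine ⟨hrange, ?_⟩
  rw [hrange, D.finrank_pi_taylorSpace, Nat.cast_sum, ← Finset.sum_sub_distrib,
    ← Finset.sum_add_distrib]
  refine Finset.sum_congr rfl fun γ _ => ?_
  have := D.finrank_taylorSpace γ (hcomp γ) (hcross γ)
  zify at this
  linarith
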